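/- Let $\ell\ge 1$ and let $(a_i)_{i\in\mathbb Z}$ be positive integers with $a_{i+\ell}=a_i$; let $\alpha=[0;\overline{a_1,\dots,a_\ell}]$. Let $p_0=1,\ p_1=0,\ q_0=0,\ q_1=1$ and $p_{n+1}=a_np_n+p_{n-1}$, $q_{n+1}=a_nq_n+q_{n-1}$ for $n\ge1$. Put $$c=q_{\ell+1}+p_\ell,\qquad a=\frac{c+\sqrt{c^2+4(-1)^{\ell-1}}}{2},\qquad b=\frac{c-\sqrt{c^2+4(-1)^{\ell-1}}}{2},$$ and, for $0\le k<\ell$, $$c_k=\frac{q_{\ell+k}-bq_k}{a-b},\qquad e_k=(-1)^{k-1}\frac{|aq_k-q_{\ell+k}|}{q_\ell},$$ extended by $c_\ell=c_0$, $e_\ell=e_0$. For $1\le k\le \ell$ let $\alpha_{\sigma_k}=[0;\overline{a_{k-1},\dots,a_1,a_\ell,\dots,a_k}]$ (the continued fraction whose $i$-th digit is $a_{k-i}$) and, for $t=1,2,\dots$, $$u_k(t)=2\left(\frac{t}{|e_kc_k|}-\{t\alpha_{\sigma_k}\}+\frac12\right).$$ Let $P_N(\alpha)=\prod_{r=1}^N|2\sin\pi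 r\alpha|$ and $P_{q_n}(\alpha,\varepsilon)=\prod_{r=1}^{q_n}2\left|\sin\pi\left(r\alpha+(-1)^{n+1}\frac{\varepsilon}{q_n}\right)\right|$ for $\varepsilon\in\mathbb R$. Then for every $k=1,\dots,\ell$ the limit $C_k=\lim_{m\to\infty}P_{q_{m\ell+k}}(\alpha)$ exists and is positive; the functions $P_{q_{m\ell+k}}(\alpha,\cdot)$ converge, as $m\to\infty$, locally uniformly on $\mathbb R$ to a function $G_k(\alpha,\cdot)$; and $C_k=G_k(\alpha,0)$. Moreover, if $\ell$ is even, then $$C_k=\left(\frac{1+a^2}{c!}\right)^{\frac1{c-2}}\prod_{t=1}^\infty\left(1-\frac1{u_k(t)^2}\right)\left|1-\frac{(1+2a^2)^2}{u_k(t)^2}\right|^{\frac1{c-2}}\prod_{s=1}^{c-1}\left|1-\frac{(1+2s)^2}{u_k(t)^2}\right|^{-\frac1{c-2}},$$ and if $\ell$ is odd, then $$C_k=\frac1{\prod_{s=1}^c|s-a|^{1/c}}\prod_{t=1}^\infty\left(1-\frac1{u_k(t)^2}\right)\prod_{s=0}^{c-1}\left|1-\frac{(1+2s-2a)^2}{u_k(t)^2}\right|^{-\frac1c},$$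 where in both cases the infinite product over $t$ (of the whole expression following the sign $\prod_{t=1}^\infty$) converges unconditionally. -/

import Mathlib

open Filter Topology

namespace SudlerCF

noncomputable section

/-- Numerators of the convergents of `[0; d 1, d 2, …]`, indexed so that `p 0 = 1`, `p 1 = 0` and
`p (n+1) = d n * p n + p (n-1)`. The digits are given by a two-sided sequence `d`. -/
def p (d : ℤ → ℕ) : ℕ → ℕ
  | 0 => 1
  | 1 => 0
  | n + 2 => d (n + 1) * p d (n + 1) + p d n

/-- Denominators of the convergents, indexed so that `q 0 = 0`, `q 1 = 1` and
`q (n+1) = d n * q n + q (n-1)`. -/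
def q (d : ℤ → ℕ) : ℕ → ℕ
  | 0 => 0
  | 1 => 1
  | n + 2 => d (n + 1) * q d (n + 1) + q d n

/-- The value of the infinite continued fraction `[0; d 1, d 2, d 3, …]`, the limit of its
convergents. -/
def cfValue (d : ℤ → ℕ) : ℝ :=
  limUnder atTop (fun n : ℕ => (p d n : ℝ) / (q d n : ℝ))

/-- For an `ℓ`-periodic two-sided sequence of digits, `σ d k` has the period
`(d (k-1), …, d 1, d ℓ, …, d k)`. -/
def σ (d : ℤ → ℕ) (k : ℕ) : ℤ → ℕ := fun i => d (k - i)

/-- `c = q_{ℓ+1} + p_ℓ`. -/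
def c (d : ℤ → ℕ) (ℓ : ℕ) : ℕ := q d (ℓ + 1) + p d ℓ

/-- `a`, the larger root of `x ^ 2 - c x + (-1) ^ ℓ`. -/
def a (d : ℤ → ℕ) (ℓ : ℕ) : ℝ :=
  ((c d ℓ : ℝ) + √((c d ℓ : ℝ) ^ 2 - 4 * (-1) ^ ℓ)) / 2

/-- `b`, the smaller root of `x ^ 2 - c x + (-1) ^ ℓ`. -/
def b (d : ℤ → ℕ) (ℓ : ℕ) : ℝ :=
  ((c d ℓ : ℝ) - √((c d ℓ : ℝ) ^ 2 - 4 * (-1) ^ ℓ)) / 2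

/-- `c_k`, defined for `0 ≤ k < ℓ` and extended periodically modulo `ℓ`. -/
def cCoeff (d : ℤ → ℕ) (ℓ k : ℕ) : ℝ :=
  ((q d (ℓ + k % ℓ) : ℝ) - b d ℓ * (q d (k % ℓ) : ℝ)) / (a d ℓ - b d ℓ)

/-- `e_k`, defined for `0 ≤ k < ℓ` and extended periodically modulo `ℓ`. -/
def eCoeff (d : ℤ → ℕ) (ℓ k : ℕ) : ℝ :=
  (-1) ^ (k % ℓ + 1) * (|a d ℓ * (q d (k % ℓ) : ℝ) - (q d (ℓ + k % ℓ) : ℝ)| / (q d ℓ : ℝ))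

/-- `u_k(t) = 2 (t / |e_k c_k| - {t α_{σ_k}} + 1/2)`. -/
def u (d : ℤ → ℕ) (ℓ k t : ℕ) : ℝ :=
  2 * ((t : ℝ) / |eCoeff d ℓ k * cCoeff d ℓ k| - Int.fract ((t : ℝ) * cfValue (σ d k)) + 1 / 2)

/-- The Sudler product `P_N(α)`. -/
def sudler (α : ℝ) (N : ℕ) : ℝ :=
  ∏ r ∈ Finset.Icc 1 N, |2 * Real.sin (Real.pi * (r * α))|

/-- The perturbed Sudler product `P_{q_n}(α, ε)`, where `α` has the digits `d`. -/
def perturbedSudler (d : ℤ → ℕ) (n : ℕ) (ε : ℝ) : ℝ :=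
  ∏ r ∈ Finset.Icc 1 (q d n),
    2 * |Real.sin (Real.pi * (r * cfValue d + (-1) ^ (n + 1) * (ε / (q d n : ℝ))))|

/-- The `t`-th factor of the infinite product for even period length. -/
def evenFactor (d : ℤ → ℕ) (ℓ k t : ℕ) : ℝ :=
  (1 - 1 / u d ℓ k t ^ 2)
    * |1 - (1 + 2 * a d ℓ ^ 2) ^ 2 / u d ℓ k t ^ 2| ^ (1 / ((c d ℓ : ℝ) - 2))
    * ∏ s ∈ Finset.Icc 1 (c d ℓ - 1),
        |1 - (1 + 2 * (s : ℝ)) ^ 2 / u d ℓ k t ^ 2| ^ (-(1 / ((c d ℓ : ℝ) - 2)))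

/-- The `t`-th factor of the infinite product for odd period length. -/
def oddFactor (d : ℤ → ℕ) (ℓ k t : ℕ) : ℝ :=
  (1 - 1 / u d ℓ k t ^ 2)
    * ∏ s ∈ Finset.range (c d ℓ),
        |1 - (1 + 2 * (s : ℝ) - 2 * a d ℓ) ^ 2 / u d ℓ k t ^ 2| ^ (-(1 / (c d ℓ : ℝ)))

end

end SudlerCF

/-!
The limits are found without evaluating any conditionally convergent product. Write `P_n(ε)` for
`P_{q_n}(α, ε)` and `λ_n = q_n |q_n α - p_n|`.

*Quotients.* Reordering the factors by the residue of `r p_n` modulo `q_n` and multiplying the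
`j`-th by the `(q_n - j)`-th gives differences of squared sines
(`perturbedSudler_eq_prod`, `pairFactor_eq`). In the quotient `P_n(ε) / P_n(0)` the paired factors
are `1 + O(1 / j ^ 2)`, so dominated convergence yields its limit `relLim` along each residue class
of `n` modulo `ℓ`, jointly in `n` and `ε` (`tendsto_relLim`). Pointwise the factors converge
because `q_{n-1} / q_n → α_{σ_k}`, which is irrational, and `λ_n → |e_k c_k|`.

*Recurrence.* Since `q_{n+2ℓ} = c q_{n+ℓ} - (-1) ^ ℓ q_n`, cutting the product into blocks gives
`P_{n+2ℓ}(0) = P_n(0) ∏_{s<c} P_{n+ℓ}((s - a) λ_{n+ℓ})` for odd `ℓ` and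
`P_n(0) P_{n+2ℓ}(a ^ 2 λ_{n+2ℓ}) = ∏_{s<c} P_{n+ℓ}(s λ_{n+ℓ})` for even `ℓ`
(`sudler_odd_eq`, `sudler_even_eq`). Dividing by values at `ε = 0` and taking logarithms,
`x_m = log P_{mℓ+k}(0)` satisfies `x_{m+2} = c x_{m+1} - (-1) ^ ℓ x_m + h_m`, where `h_m` converges
by the first step. The characteristic roots are `a > 1` and `b` with `|b| < 1`, and
`x_m = O(log q_{mℓ+k}) = o(a ^ m)` (`tendsto_log_sudler_div`), which excludes the expanding
direction; hence `x_m` converges (`tendsto_of_recurrence`), and its limit, determined by that of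
`h_m`, is the logarithm of the stated formula.

*Nonvanishing.* For `h_m` to converge, `relLim` must not vanish at the perturbations involved. The
corresponding points are multiples `r α` with `r = O(q_n)`, and `α` is badly approximable, so
no factor of the limit vanishes there (`one_sub_div_u_sq_ne_zero`).
-/

namespace SudlerCF

/-! ### Continued fractions with arbitrary digits -/

lemma q_add_two (d : ℤ → ℕ) (n : ℕ) : q d (n + 2) = d (n + 1) * q d (n + 1) + q d n := rfl

lemma p_add_two (d : ℤ → ℕ) (n : ℕ) : p d (n + 2) = d (n + 1) * p d (n + 1) + p d n := rfl

lemma q_succ_pos {d : ℤ → ℕ} (hpos : ∀ i, 1 ≤ d i) (n : ℕ) : 0 < q d (n + 1) := by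
  induction n with
  | zero => simp [q]
  | succ n ih =>
    rw [q_add_two]
    have := Nat.mul_le_mul_right (q d (n + 1)) (hpos (n + 1))
    omega

lemma q_pos {d : ℤ → ℕ} (hpos : ∀ i, 1 ≤ d i) {n : ℕ} (hn : 1 ≤ n) : 0 < q d n := by
  obtain ⟨n, rfl⟩ := Nat.exists_eq_add_of_le' hn
  exact q_succ_pos hpos n

lemma q_add_le {d : ℤ → ℕ} (hpos : ∀ i, 1 ≤ d i) (n : ℕ) :
    q d (n + 1) + q d n ≤ q d (n + 2) := by
  rw [q_add_two]
  have := Nat.mul_le_mul_right (q d (n + 1)) (hpos (n + 1))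
  omega

lemma q_le_succ {d : ℤ → ℕ} (hpos : ∀ i, 1 ≤ d i) (n : ℕ) : q d n ≤ q d (n + 1) := by
  cases n with
  | zero => simp [q]
  | succ n => exact le_trans (Nat.le_add_right _ _) (q_add_le hpos n)

lemma p_mul_q_sub (d : ℤ → ℕ) (n : ℕ) :
    (p d (n + 1) * q d n - p d n * q d (n + 1) : ℤ) = (-1) ^ (n + 1) := by
  induction n with
  | zero => simp [p, q]
  | succ n ih =>
    rw [q_add_two, p_add_two, pow_succ, ← ih]
    push_cast
    ring

lemma two_pow_le_q_mul_q {d : ℤ → ℕ} (hpos : ∀ i, 1 ≤ d i) (n : ℕ) :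
    2 ^ n ≤ q d (n + 1) * q d (n + 2) := by
  induction n with
  | zero => exact Nat.mul_pos (q_succ_pos hpos 0) (q_succ_pos hpos 1)
  | succ n ih =>
    have h1 : q d (n + 2) + q d (n + 1) ≤ q d (n + 3) := q_add_le hpos (n + 1)
    have h2 : q d (n + 1) ≤ q d (n + 2) := q_le_succ hpos (n + 1)
    calc 2 ^ (n + 1) = 2 ^ n * 2 := pow_succ 2 n
      _ ≤ (q d (n + 1) * q d (n + 2)) * 2 := Nat.mul_le_mul_right 2 ih
      _ = q d (n + 2) * (q d (n + 1) + q d (n + 1)) := by ring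
      _ ≤ q d (n + 2) * q d (n + 3) := Nat.mul_le_mul_left _ (by omega)

/-- The limit defining `cfValue` exists. -/
lemma tendsto_cfValue {d : ℤ → ℕ} (hpos : ∀ i, 1 ≤ d i) :
    Tendsto (fun n : ℕ => (p d n : ℝ) / (q d n : ℝ)) atTop (𝓝 (cfValue d)) := by
  have key : CauchySeq (fun n : ℕ => (p d (n + 1) : ℝ) / (q d (n + 1) : ℝ)) := by
    refine cauchySeq_of_le_geometric (1 / 2) 1 (by norm_num) fun n => ?_
    have h1 : (0 : ℝ) < q d (n + 1) := by exact_mod_cast q_succ_pos hpos n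
    have h2 : (0 : ℝ) < q d (n + 2) := by exact_mod_cast q_succ_pos hpos (n + 1)
    have hdet : (p d (n + 2) * q d (n + 1) - p d (n + 1) * q d (n + 2) : ℝ) = (-1) ^ (n + 2) := by
      exact_mod_cast p_mul_q_sub d (n + 1)
    have h3 : (2 : ℝ) ^ n ≤ q d (n + 1) * q d (n + 2) := by
      exact_mod_cast two_pow_le_q_mul_q hpos n
    rw [dist_comm, Real.dist_eq, div_sub_div _ _ h2.ne' h1.ne',
      mul_comm (q d (n + 2) : ℝ) (p d (n + 1)), hdet, abs_div, abs_pow, abs_neg, abs_one, one_pow,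
      abs_of_pos (mul_pos h2 h1), one_mul,
      one_div_pow, mul_comm (q d (n + 2) : ℝ)]
    exact one_div_le_one_div_of_le (by positivity) h3
  obtain ⟨x, hx⟩ := cauchySeq_tendsto_of_complete key
  exact tendsto_nhds_limUnder ⟨x, (tendsto_add_atTop_iff_nat 1).1 hx⟩

/-- The digit sequence shifted by `n` places. -/
def shift (d : ℤ → ℕ) (n : ℕ) : ℤ → ℕ := fun i => d (i + n)

lemma shift_zero (d : ℤ → ℕ) : shift d 0 = d := by
  funext i; simp [shift]

lemma shift_shift (d : ℤ → ℕ) (m n : ℕ) : shift (shift d m) n = shift d (m + n) := by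
  funext i; simp only [shift]; congr 1; push_cast; ring

lemma p_q_shift (d : ℤ → ℕ) (n : ℕ) :
    p d (n + 1) = q (shift d 1) n ∧ q d (n + 1) = d 1 * q (shift d 1) n + p (shift d 1) n := by
  induction n using Nat.twoStepInduction with
  | zero => simp [p, q]
  | one => simp [p, q]
  | more n h1 h2 =>
    have hs : shift d 1 (n + 1) = d (n + 1 + 1) := rfl
    constructor
    · rw [p_add_two, q_add_two, h1.1, h2.1, hs]; push_cast; rfl
    · rw [q_add_two d, q_add_two (shift d 1), p_add_two (shift d 1), h1.2, h2.2, hs]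
      push_cast; ring

lemma cfValue_nonneg {d : ℤ → ℕ} (hpos : ∀ i, 1 ≤ d i) : 0 ≤ cfValue d :=
  ge_of_tendsto' (tendsto_cfValue hpos) fun n => by positivity

lemma cfValue_eq {d : ℤ → ℕ} (hpos : ∀ i, 1 ≤ d i) :
    cfValue d = 1 / (d 1 + cfValue (shift d 1)) := by
  have hpos' : ∀ i, 1 ≤ shift d 1 i := fun i => hpos _
  have h0 := cfValue_nonneg hpos'
  have h1 : (1 : ℝ) ≤ d 1 := by exact_mod_cast hpos 1
  refine tendsto_nhds_unique ((tendsto_add_atTop_iff_nat 1).2 (tendsto_cfValue hpos)) ?_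
  refine Tendsto.congr' ?_ ((tendsto_const_nhds (x := (1 : ℝ))).div
    ((tendsto_cfValue hpos').const_add (d 1 : ℝ)) (by linarith))
  filter_upwards [eventually_ge_atTop 1] with n hn
  have hq : (0 : ℝ) < q (shift d 1) n := by exact_mod_cast q_pos hpos' hn
  rw [(p_q_shift d n).1, (p_q_shift d n).2]
  push_cast
  simp only [Pi.div_apply]
  field_simp

lemma cfValue_pos {d : ℤ → ℕ} (hpos : ∀ i, 1 ≤ d i) : 0 < cfValue d := by
  have h0 := cfValue_nonneg (d := shift d 1) fun i => hpos _
  have h1 : (1 : ℝ) ≤ d 1 := by exact_mod_cast hpos 1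
  rw [cfValue_eq hpos]
  positivity

lemma cfValue_lt_one {d : ℤ → ℕ} (hpos : ∀ i, 1 ≤ d i) : cfValue d < 1 := by
  have h0 := cfValue_pos (d := shift d 1) fun i => hpos _
  have h1 : (1 : ℝ) ≤ d 1 := by exact_mod_cast hpos 1
  rw [cfValue_eq hpos, div_lt_one] <;> linarith

/-- The tail `[0; d (n+1), d (n+2), …]`. -/
noncomputable def tail (d : ℤ → ℕ) (n : ℕ) : ℝ := cfValue (shift d n)

lemma tail_pos {d : ℤ → ℕ} (hpos : ∀ i, 1 ≤ d i) (n : ℕ) : 0 < tail d n :=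
  cfValue_pos fun _ => hpos _

lemma tail_lt_one {d : ℤ → ℕ} (hpos : ∀ i, 1 ≤ d i) (n : ℕ) : tail d n < 1 :=
  cfValue_lt_one fun _ => hpos _

lemma tail_mul {d : ℤ → ℕ} (hpos : ∀ i, 1 ≤ d i) (n : ℕ) :
    tail d n * (d (n + 1) + tail d (n + 1)) = 1 := by
  have h0 := tail_pos hpos (n + 1)
  have h : tail d n = 1 / (d (n + 1) + tail d (n + 1)) := by
    rw [tail, cfValue_eq (d := shift d n) fun _ => hpos _, shift_shift, tail]
    simp [shift, add_comm]
  rw [h]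
  field_simp

/-- The signed error `q_n α - p_n` of the `n`-th convergent. -/
noncomputable def err (d : ℤ → ℕ) (n : ℕ) : ℝ := q d n * cfValue d - p d n

lemma err_zero (d : ℤ → ℕ) : err d 0 = -1 := by simp [err, p, q]

lemma err_one (d : ℤ → ℕ) : err d 1 = cfValue d := by simp [err, p, q]

lemma err_add_two (d : ℤ → ℕ) (n : ℕ) :
    err d (n + 2) = d (n + 1) * err d (n + 1) + err d n := by
  simp only [err, q_add_two, p_add_two]; push_cast; ring

lemma err_succ {d : ℤ → ℕ} (hpos : ∀ i, 1 ≤ d i) (n : ℕ) :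
    err d (n + 1) = -(tail d n * err d n) := by
  induction n with
  | zero => simp [err_zero, err_one, tail, shift_zero]
  | succ n ih =>
    have h := tail_mul hpos n
    have h2 : err d n = -((d (n + 1) + tail d (n + 1)) * err d (n + 1)) := by
      rw [ih]; linear_combination (-err d n) * h
    rw [err_add_two, h2]; ring

lemma err_eq_sign_mul_and_ne_zero {d : ℤ → ℕ} (hpos : ∀ i, 1 ≤ d i) (n : ℕ) :
    err d n = (-1) ^ (n + 1) * |err d n| ∧ err d n ≠ 0 := by
  induction n with
  | zero => simp [err_zero]
  | succ n ih =>
    have ht := tail_pos hpos n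
    refine ⟨?_, ?_⟩
    · rw [err_succ hpos, abs_neg, abs_mul, abs_of_pos ht]
      nth_rewrite 1 [ih.1]
      ring
    · rw [err_succ hpos, neg_ne_zero]
      exact mul_ne_zero ht.ne' ih.2

lemma abs_err_pos {d : ℤ → ℕ} (hpos : ∀ i, 1 ≤ d i) (n : ℕ) : 0 < |err d n| :=
  abs_pos.2 (err_eq_sign_mul_and_ne_zero hpos n).2

lemma abs_err_succ {d : ℤ → ℕ} (hpos : ∀ i, 1 ≤ d i) (n : ℕ) :
    |err d (n + 1)| = tail d n * |err d n| := by
  rw [err_succ hpos, abs_neg, abs_mul, abs_of_pos (tail_pos hpos n)]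

lemma abs_err_succ_lt {d : ℤ → ℕ} (hpos : ∀ i, 1 ≤ d i) (n : ℕ) :
    |err d (n + 1)| < |err d n| := by
  rw [abs_err_succ hpos]
  have := tail_lt_one hpos n
  have := abs_err_pos hpos n
  nlinarith

lemma q_mul_abs_err {d : ℤ → ℕ} (hpos : ∀ i, 1 ≤ d i) (n : ℕ) :
    q d (n + 1) * |err d n| + q d n * |err d (n + 1)| = 1 := by
  have hdet : (p d (n + 1) * q d n - p d n * q d (n + 1) : ℝ) = (-1) ^ (n + 1) := by
    exact_mod_cast p_mul_q_sub d n
  have h1 := (err_eq_sign_mul_and_ne_zero hpos n).1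
  have h2 := (err_eq_sign_mul_and_ne_zero hpos (n + 1)).1
  have hs : ((-1 : ℝ) ^ (n + 1)) * (-1) ^ (n + 1) = 1 := by
    rw [← mul_pow]; norm_num
  have h3 : q d (n + 1) * err d n - q d n * err d (n + 1) = (-1) ^ (n + 1) := by
    rw [← hdet, err, err]; ring
  rw [h1, h2, pow_succ _ (n + 1)] at h3
  linear_combination ((-1 : ℝ) ^ (n + 1)) * h3 +
    (1 - q d (n + 1) * |err d n| - q d n * |err d (n + 1)|) * hs

lemma cfValue_irrational {d : ℤ → ℕ} (hpos : ∀ i, 1 ≤ d i) : Irrational (cfValue d) := by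
  rintro ⟨r, hr⟩
  -- the nonzero integers `r.den * (q_n r - p_n)` would tend to zero
  have hle (n : ℕ) : 1 ≤ (r.den : ℝ) * |err d n| := by
    have hden : (r.den : ℝ) ≠ 0 := by exact_mod_cast r.den_ne_zero
    have h1 : (r.den : ℝ) * err d n = ((q d n * r.num - p d n * r.den : ℤ) : ℝ) := by
      rw [err, ← hr]
      nth_rewrite 2 [← Rat.num_div_den r]
      push_cast
      field_simp
    have h2 : (q d n * r.num - p d n * r.den : ℤ) ≠ 0 := by
      intro h0
      rw [h0, Int.cast_zero] at h1
      exact (mul_ne_zero hden (err_eq_sign_mul_and_ne_zero hpos n).2) h1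
    have h3 : (1 : ℝ) ≤ |((q d n * r.num - p d n * r.den : ℤ) : ℝ)| := by
      rw [← Int.cast_abs]; exact_mod_cast Int.one_le_abs h2
    rwa [← h1, abs_mul, Nat.abs_cast] at h3
  have hq (n : ℕ) : (q d (n + 1) : ℝ) ≤ r.den := by
    have h1 := hle n
    have h2 := q_mul_abs_err hpos n
    have h3 : (0 : ℝ) ≤ q d n * |err d (n + 1)| := by positivity
    have h4 := abs_err_pos hpos n
    have h5 : (q d (n + 1) : ℝ) * |err d n| ≤ r.den * |err d n| := by linarith
    exact le_of_mul_le_mul_right h5 h4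
  have hb (n : ℕ) : (2 : ℝ) ^ n ≤ r.den * r.den := by
    calc (2 : ℝ) ^ n ≤ q d (n + 1) * q d (n + 2) := by exact_mod_cast two_pow_le_q_mul_q hpos n
      _ ≤ _ := mul_le_mul (hq n) (hq (n + 1)) (by positivity) (by positivity)
  obtain ⟨n, hn⟩ := pow_unbounded_of_one_lt ((r.den : ℝ) * r.den) one_lt_two
  exact absurd (hb n) (not_le.2 hn)

/-- Every solution of the recurrence of the convergents is a combination of `p` and `q`. -/
lemma recurrence_eq {d : ℤ → ℕ} {X : ℕ → ℝ}
    (hX : ∀ n : ℕ, X (n + 2) = d (n + 1) * X (n + 1) + X n) (n : ℕ) :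
    X n = X 0 * p d n + X 1 * q d n := by
  induction n using Nat.twoStepInduction with
  | zero => simp [p, q]
  | one => simp [p, q]
  | more n h1 h2 =>
    rw [hX, h1, h2, p_add_two, q_add_two]; push_cast; ring

/-! ### Periodic digits -/

lemma digit_add_mul {d : ℤ → ℕ} {ℓ : ℕ} (hper : ∀ i, d (i + ℓ) = d i) (i : ℤ) (m : ℕ) :
    d (i + m * ℓ) = d i := by
  induction m with
  | zero => simp
  | succ m ih => rw [← ih, ← hper (i + m * ℓ)]; congr 1; push_cast; ring

lemma shift_mul {d : ℤ → ℕ} {ℓ : ℕ} (hper : ∀ i, d (i + ℓ) = d i) (m k : ℕ) :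
    shift d (m * ℓ + k) = shift d k := by
  funext i
  simp only [shift]
  rw [← digit_add_mul hper (i + k) m]
  congr 1; push_cast; ring

lemma σ_mul {d : ℤ → ℕ} {ℓ : ℕ} (hper : ∀ i, d (i + ℓ) = d i) (m k : ℕ) :
    σ d (m * ℓ + k) = σ d k := by
  funext i
  simp only [σ]
  rw [← digit_add_mul hper (k - i) m]
  congr 1; push_cast; ring

lemma q_add_period {d : ℤ → ℕ} {ℓ : ℕ} (hper : ∀ i, d (i + ℓ) = d i) (n : ℕ) :
    (q d (n + ℓ) : ℝ) = q d ℓ * p d n + q d (ℓ + 1) * q d n := by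
  have h := recurrence_eq (d := d) (X := fun n => (q d (n + ℓ) : ℝ)) (fun n => ?_) n
  · simpa [add_comm 1 ℓ] using h
  · have h1 : n + 2 + ℓ = (n + ℓ) + 2 := by ring
    have h2 : n + 1 + ℓ = (n + ℓ) + 1 := by ring
    have h3 : d ((n + ℓ : ℕ) + 1) = d (n + 1) := by rw [← hper (n + 1)]; congr 1; push_cast; ring
    simp only [h1, h2, q_add_two]
    push_cast at h3 ⊢
    rw [h3]

lemma p_add_period {d : ℤ → ℕ} {ℓ : ℕ} (hper : ∀ i, d (i + ℓ) = d i) (n : ℕ) :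
    (p d (n + ℓ) : ℝ) = p d ℓ * p d n + p d (ℓ + 1) * q d n := by
  have h := recurrence_eq (d := d) (X := fun n => (p d (n + ℓ) : ℝ)) (fun n => ?_) n
  · simpa [add_comm 1 ℓ] using h
  · have h1 : n + 2 + ℓ = (n + ℓ) + 2 := by ring
    have h2 : n + 1 + ℓ = (n + ℓ) + 1 := by ring
    have h3 : d ((n + ℓ : ℕ) + 1) = d (n + 1) := by rw [← hper (n + 1)]; congr 1; push_cast; ring
    simp only [h1, h2, p_add_two]
    push_cast at h3 ⊢
    rw [h3]

lemma q_add_two_period {d : ℤ → ℕ} {ℓ : ℕ} (hper : ∀ i, d (i + ℓ) = d i) (n : ℕ) :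
    (q d (n + 2 * ℓ) : ℝ) = c d ℓ * q d (n + ℓ) - (-1) ^ ℓ * q d n := by
  have hdet : (p d (ℓ + 1) * q d ℓ - p d ℓ * q d (ℓ + 1) : ℝ) = (-1) ^ (ℓ + 1) := by
    exact_mod_cast p_mul_q_sub d ℓ
  have h : n + 2 * ℓ = (n + ℓ) + ℓ := by ring
  rw [h, q_add_period hper, p_add_period hper, q_add_period hper n, c]
  push_cast
  rw [pow_succ] at hdet
  linear_combination (q d n : ℝ) * hdet

lemma p_add_two_period {d : ℤ → ℕ} {ℓ : ℕ} (hper : ∀ i, d (i + ℓ) = d i) (n : ℕ) :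
    (p d (n + 2 * ℓ) : ℝ) = c d ℓ * p d (n + ℓ) - (-1) ^ ℓ * p d n := by
  have hdet : (p d (ℓ + 1) * q d ℓ - p d ℓ * q d (ℓ + 1) : ℝ) = (-1) ^ (ℓ + 1) := by
    exact_mod_cast p_mul_q_sub d ℓ
  have h : n + 2 * ℓ = (n + ℓ) + ℓ := by ring
  rw [h, p_add_period hper, q_add_period hper, p_add_period hper n, c]
  push_cast
  rw [pow_succ] at hdet
  linear_combination (p d n : ℝ) * hdet

lemma one_le_c {d : ℤ → ℕ} (hpos : ∀ i, 1 ≤ d i) (ℓ : ℕ) : 1 ≤ c d ℓ := by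
  have := q_succ_pos hpos ℓ
  rw [c]; omega

/-- For even periods the exponent `1 / (c - 2)` is therefore meaningful. -/
lemma three_le_c {d : ℤ → ℕ} (hpos : ∀ i, 1 ≤ d i) {ℓ : ℕ} (hℓ : 2 ≤ ℓ) : 3 ≤ c d ℓ := by
  obtain ⟨n, rfl⟩ := Nat.exists_eq_add_of_le' hℓ
  have h1 : q d (n + 2) + q d (n + 1) ≤ q d (n + 2 + 1) := q_add_le hpos (n + 1)
  have h2 := q_succ_pos hpos n
  have h3 := q_succ_pos hpos (n + 1)
  have h4 : 0 < p d (n + 2) := by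
    rw [(p_q_shift d (n + 1)).1]
    exact q_succ_pos (fun _ => hpos _) n
  have h5 : 0 < q d (n + 2) := h3
  rw [c]; omega

lemma a_add_b (d : ℤ → ℕ) (ℓ : ℕ) : a d ℓ + b d ℓ = c d ℓ := by
  rw [a, b]; ring

lemma one_lt_a_and_a_mul_b {d : ℤ → ℕ} {ℓ : ℕ} (hℓ : 1 ≤ ℓ) (hpos : ∀ i, 1 ≤ d i) :
    1 < a d ℓ ∧ a d ℓ * b d ℓ = (-1) ^ ℓ := by
  have h1 : (1 : ℝ) ≤ c d ℓ := by exact_mod_cast one_le_c hpos ℓ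
  rcases Nat.even_or_odd ℓ with he | ho
  · have h3 : (3 : ℝ) ≤ c d ℓ := by
      exact_mod_cast three_le_c hpos (by obtain ⟨r, rfl⟩ := he; omega)
    have hs := Real.mul_self_sqrt (show (0 : ℝ) ≤ (c d ℓ : ℝ) ^ 2 - 4 * (-1) ^ ℓ by
      rw [he.neg_one_pow]; nlinarith)
    have hs0 := Real.sqrt_nonneg ((c d ℓ : ℝ) ^ 2 - 4 * (-1) ^ ℓ)
    exact ⟨by rw [a]; linarith, by rw [a, b]; linear_combination (-1 / 4 : ℝ) * hs⟩
  · have hs := Real.mul_self_sqrt (show (0 : ℝ) ≤ (c d ℓ : ℝ) ^ 2 - 4 * (-1) ^ ℓ by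
      rw [ho.neg_one_pow]; nlinarith)
    have hs0 := Real.sqrt_nonneg ((c d ℓ : ℝ) ^ 2 - 4 * (-1) ^ ℓ)
    refine ⟨?_, by rw [a, b]; linear_combination (-1 / 4 : ℝ) * hs⟩
    have : 1 < √((c d ℓ : ℝ) ^ 2 - 4 * (-1) ^ ℓ) := by
      rw [Real.lt_sqrt (by norm_num), ho.neg_one_pow]; nlinarith
    rw [a]; linarith

lemma abs_b_mul_a {d : ℤ → ℕ} {ℓ : ℕ} (hℓ : 1 ≤ ℓ) (hpos : ∀ i, 1 ≤ d i) :
    |b d ℓ| * a d ℓ = 1 := by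
  obtain ⟨h1, h2⟩ := one_lt_a_and_a_mul_b hℓ hpos
  rw [← abs_of_pos (zero_lt_one.trans h1), ← abs_mul, mul_comm, h2]
  simp

lemma abs_b_lt_one {d : ℤ → ℕ} {ℓ : ℕ} (hℓ : 1 ≤ ℓ) (hpos : ∀ i, 1 ≤ d i) : |b d ℓ| < 1 := by
  have h1 := (one_lt_a_and_a_mul_b hℓ hpos).1
  have h2 := abs_b_mul_a hℓ hpos
  have h3 := abs_nonneg (b d ℓ)
  nlinarith

lemma b_lt_a {d : ℤ → ℕ} {ℓ : ℕ} (hℓ : 1 ≤ ℓ) (hpos : ∀ i, 1 ≤ d i) : b d ℓ < a d ℓ :=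
  (le_abs_self _).trans_lt ((abs_b_lt_one hℓ hpos).trans (one_lt_a_and_a_mul_b hℓ hpos).1)

lemma abs_err_lt_one {d : ℤ → ℕ} (hpos : ∀ i, 1 ≤ d i) {n : ℕ} (hn : 1 ≤ n) :
    |err d n| < 1 := by
  have := strictAnti_nat_of_succ_lt (f := fun n => |err d n|) (abs_err_succ_lt hpos)
    (show 0 < n from hn)
  simpa [err_zero] using this

lemma err_add_two_period {d : ℤ → ℕ} {ℓ : ℕ} (hper : ∀ i, d (i + ℓ) = d i) (n : ℕ) :
    err d (n + 2 * ℓ) = c d ℓ * err d (n + ℓ) - (-1) ^ ℓ * err d n := by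
  simp only [err, q_add_two_period hper, p_add_two_period hper]; ring

/-- Translation by a period multiplies the errors by the contracting eigenvalue `b`. -/
lemma err_add_period {d : ℤ → ℕ} {ℓ : ℕ} (hℓ : 1 ≤ ℓ) (hpos : ∀ i, 1 ≤ d i)
    (hper : ∀ i, d (i + ℓ) = d i) (n : ℕ) : err d (n + ℓ) = b d ℓ * err d n := by
  have htail : tail d ℓ = cfValue d := by
    have := shift_mul hper 1 0
    rw [one_mul, add_zero, shift_zero] at this
    rw [tail, this]
  have hκ (n : ℕ) : err d (n + ℓ) = -err d ℓ * err d n := by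
    have h := recurrence_eq (d := d) (X := fun n => err d (n + ℓ)) (fun n => ?_) n
    · simp only [zero_add, add_comm 1 ℓ] at h
      rw [h, err_succ hpos ℓ, htail, err.eq_def d n]; ring
    · have h1 : n + 2 + ℓ = (n + ℓ) + 2 := by ring
      have h2 : n + 1 + ℓ = (n + ℓ) + 1 := by ring
      have h3 : d ((n + ℓ : ℕ) + 1) = d (n + 1) := by rw [← hper (n + 1)]; congr 1; push_cast; ring
      simp only [h1, h2, err_add_two, h3]
  obtain ⟨h1, h2⟩ := one_lt_a_and_a_mul_b hℓ hpos
  have h0 := err_add_two_period hper 0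
  rw [zero_add, zero_add, two_mul, hκ ℓ, err_zero] at h0
  -- the multiplier `-err d ℓ` is a characteristic root of absolute value below `1`
  have hroot : (-err d ℓ - a d ℓ) * (-err d ℓ - b d ℓ) = 0 := by
    have := a_add_b d ℓ
    linear_combination -h0 + h2 + err d ℓ * this
  rcases mul_eq_zero.1 hroot with h | h
  · have := abs_lt.1 (abs_err_lt_one hpos hℓ)
    linarith [this.1]
  · rw [hκ, show -err d ℓ = b d ℓ by linarith]

lemma err_add_mul {d : ℤ → ℕ} {ℓ : ℕ} (hℓ : 1 ≤ ℓ) (hpos : ∀ i, 1 ≤ d i)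
    (hper : ∀ i, d (i + ℓ) = d i) (m k : ℕ) : err d (m * ℓ + k) = b d ℓ ^ m * err d k := by
  induction m with
  | zero => simp
  | succ m ih =>
    rw [show (m + 1) * ℓ + k = (m * ℓ + k) + ℓ by ring, err_add_period hℓ hpos hper, ih, pow_succ]
    ring

lemma q_add_mul {d : ℤ → ℕ} {ℓ : ℕ} (hℓ : 1 ≤ ℓ) (hpos : ∀ i, 1 ≤ d i)
    (hper : ∀ i, d (i + ℓ) = d i) (m k : ℕ) :
    (a d ℓ - b d ℓ) * q d (m * ℓ + k) = (q d (ℓ + k) - b d ℓ * q d k) * a d ℓ ^ m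
      + (a d ℓ * q d k - q d (ℓ + k)) * b d ℓ ^ m := by
  have hs := a_add_b d ℓ
  have hm := (one_lt_a_and_a_mul_b hℓ hpos).2
  induction m using Nat.twoStepInduction with
  | zero => simp; ring
  | one => simp; ring
  | more m h1 h2 =>
    have h := q_add_two_period hper (m * ℓ + k)
    rw [show m * ℓ + k + 2 * ℓ = (m + 2) * ℓ + k by ring,
      show m * ℓ + k + ℓ = (m + 1) * ℓ + k by ring, ← hs, ← hm] at h
    rw [h]
    linear_combination (a d ℓ + b d ℓ) * h2 - a d ℓ * b d ℓ * h1

/-- The limit of `q_n |q_n α - p_n|` along `n ≡ k` modulo the period. -/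
noncomputable def errLim (d : ℤ → ℕ) (ℓ k : ℕ) : ℝ := |eCoeff d ℓ k * cCoeff d ℓ k|

lemma abs_eCoeff {d : ℤ → ℕ} {ℓ : ℕ} (hℓ : 1 ≤ ℓ) (hpos : ∀ i, 1 ≤ d i)
    (hper : ∀ i, d (i + ℓ) = d i) (k : ℕ) : |eCoeff d ℓ k| = |err d (k % ℓ)| := by
  have hq : (0 : ℝ) < q d ℓ := by exact_mod_cast q_pos hpos hℓ
  have h0 := err_add_period hℓ hpos hper 0
  rw [zero_add, err_zero, err] at h0
  have hs := a_add_b d ℓ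
  have h : a d ℓ * q d (k % ℓ) - q d (ℓ + k % ℓ) = q d ℓ * err d (k % ℓ) := by
    rw [add_comm ℓ, q_add_period hper, err]
    rw [c] at hs
    push_cast at hs
    linear_combination (q d (k % ℓ) : ℝ) * (hs - h0)
  rw [eCoeff, h, abs_mul, abs_mul (q d ℓ : ℝ), abs_of_pos hq, mul_div_cancel_left₀ _ hq.ne']
  simp

lemma abs_err_mul_a_pow {d : ℤ → ℕ} {ℓ : ℕ} (hℓ : 1 ≤ ℓ) (hpos : ∀ i, 1 ≤ d i)
    (hper : ∀ i, d (i + ℓ) = d i) (m k : ℕ) :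
    |err d (m * ℓ + k)| * a d ℓ ^ m = |err d k| := by
  rw [err_add_mul hℓ hpos hper, abs_mul, abs_pow, mul_right_comm, ← mul_pow, abs_b_mul_a hℓ hpos]
  simp

lemma tendsto_q_mul_err_of_lt {d : ℤ → ℕ} {ℓ : ℕ} (hℓ : 1 ≤ ℓ) (hpos : ∀ i, 1 ≤ d i)
    (hper : ∀ i, d (i + ℓ) = d i) (k : ℕ) :
    Tendsto (fun m : ℕ => (q d (m * ℓ + k % ℓ) : ℝ) * |err d (m * ℓ + k % ℓ)|) atTop
      (𝓝 (errLim d ℓ k)) := by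
  have hab := sub_pos.2 (b_lt_a hℓ hpos)
  have ha := (one_lt_a_and_a_mul_b hℓ hpos).1
  have hc : 0 ≤ cCoeff d ℓ k := by
    rw [cCoeff]
    refine div_nonneg ?_ hab.le
    have h1 : (q d (k % ℓ) : ℝ) ≤ q d (ℓ + k % ℓ) := by
      exact_mod_cast monotone_nat_of_le_succ (q_le_succ hpos) (Nat.le_add_left _ _)
    have h2 := (abs_lt.1 (abs_b_lt_one hℓ hpos)).2
    have h3 : (0 : ℝ) ≤ q d (k % ℓ) := by positivity
    nlinarith
  have hb : Tendsto (fun m : ℕ => (b d ℓ * |b d ℓ|) ^ m) atTop (𝓝 0) := by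
    apply tendsto_pow_atTop_nhds_zero_of_abs_lt_one
    rw [abs_mul, abs_abs]
    have := abs_b_lt_one hℓ hpos
    have := abs_nonneg (b d ℓ)
    nlinarith
  have key (m : ℕ) : (q d (m * ℓ + k % ℓ) : ℝ) * |err d (m * ℓ + k % ℓ)| =
      |err d (k % ℓ)| * (cCoeff d ℓ k + (a d ℓ * q d (k % ℓ) - q d (ℓ + k % ℓ)) / (a d ℓ - b d ℓ)
        * (b d ℓ * |b d ℓ|) ^ m) := by
    have hq := q_add_mul hℓ hpos hper m (k % ℓ)
    have h1 : (|b d ℓ| * a d ℓ) ^ m = 1 := by rw [abs_b_mul_a hℓ hpos, one_pow]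
    rw [mul_pow] at h1
    rw [err_add_mul hℓ hpos hper, abs_mul, abs_pow, cCoeff, mul_pow]
    field_simp
    linear_combination |b d ℓ| ^ m * |err d (k % ℓ)| * hq +
      |err d (k % ℓ)| * (q d (ℓ + k % ℓ) - b d ℓ * q d (k % ℓ)) * h1
  simp only [key]
  rw [errLim, abs_mul, abs_eCoeff hℓ hpos hper, abs_of_nonneg hc]
  simpa using (((hb.const_mul _).const_add _).const_mul _)

lemma tendsto_q_mul_err {d : ℤ → ℕ} {ℓ : ℕ} (hℓ : 1 ≤ ℓ) (hpos : ∀ i, 1 ≤ d i)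
    (hper : ∀ i, d (i + ℓ) = d i) (k : ℕ) :
    Tendsto (fun m : ℕ => (q d (m * ℓ + k) : ℝ) * |err d (m * ℓ + k)|) atTop
      (𝓝 (errLim d ℓ k)) := by
  have h := (tendsto_add_atTop_iff_nat (k / ℓ)).2 (tendsto_q_mul_err_of_lt hℓ hpos hper k)
  refine h.congr fun m => ?_
  have : (m + k / ℓ) * ℓ + k % ℓ = m * ℓ + k := by
    rw [add_mul, add_assoc, mul_comm (k / ℓ), Nat.div_add_mod]
  rw [this]

/-! ### The reversed expansion -/

lemma σ_pos {d : ℤ → ℕ} (hpos : ∀ i, 1 ≤ d i) (k : ℕ) (i : ℤ) : 1 ≤ σ d k i := hpos _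

lemma cfValue_σ_succ {d : ℤ → ℕ} (hpos : ∀ i, 1 ≤ d i) (n : ℕ) :
    cfValue (σ d (n + 1)) * (d n + cfValue (σ d n)) = 1 := by
  have h := tail_mul (σ_pos hpos (n + 1)) 0
  have h1 : shift (σ d (n + 1)) 1 = σ d n := by
    funext i; simp only [shift, σ]; congr 1; push_cast; ring
  have h2 : σ d (n + 1) ((0 : ℕ) + 1) = d n := by
    simp only [σ]; congr 1; push_cast; ring
  rwa [tail, shift_zero, tail, zero_add, h1, h2] at h

/-- By reversal, `q_{n-1} / q_n = [0; a_{n-1}, …, a_1]`, whence the limit. -/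
lemma tendsto_q_div_q {d : ℤ → ℕ} {ℓ : ℕ} (hℓ : 1 ≤ ℓ) (hpos : ∀ i, 1 ≤ d i)
    (hper : ∀ i, d (i + ℓ) = d i) (k : ℕ) :
    Tendsto (fun m : ℕ => (q d (m * ℓ + k - 1) : ℝ) / q d (m * ℓ + k)) atTop
      (𝓝 (cfValue (σ d k))) := by
  -- both sequences obey `x_{n+1} = 1 / (d n + x_n)`, a map contracting by `1 / (d n + θ_n) < ρ`
  have hfin : ∃ ρ < (1 : ℝ), ∀ n, cfValue (σ d n) ≤ ρ := by
    obtain ⟨j, -, hj⟩ := Finset.exists_max_image (Finset.range ℓ) (fun n => cfValue (σ d n))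
      ⟨0, Finset.mem_range.2 hℓ⟩
    refine ⟨cfValue (σ d j), cfValue_lt_one (σ_pos hpos j), fun n => ?_⟩
    have := hj (n % ℓ) (Finset.mem_range.2 (Nat.mod_lt n hℓ))
    rwa [← σ_mul hper (n / ℓ) (n % ℓ), mul_comm, Nat.div_add_mod] at this
  obtain ⟨ρ, hρ, hle⟩ := hfin
  have hρ0 : 0 ≤ ρ := (cfValue_nonneg (σ_pos hpos 0)).trans (hle 0)
  have hstep (n : ℕ) : |(q d n : ℝ) / q d (n + 1) - cfValue (σ d (n + 1))| ≤ ρ ^ n := by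
    induction n with
    | zero =>
      have h1 := cfValue_pos (σ_pos hpos 1)
      have h2 := cfValue_lt_one (σ_pos hpos 1)
      simp [q, abs_of_pos h1, h2.le]
    | succ n ih =>
      have h1 : (0 : ℝ) < q d (n + 1) := by exact_mod_cast q_succ_pos hpos n
      have h2 : (0 : ℝ) < q d (n + 2) := by exact_mod_cast q_succ_pos hpos (n + 1)
      have h3 := cfValue_σ_succ hpos (n + 1)
      have h4 := cfValue_pos (σ_pos hpos (n + 1))
      have h5 := cfValue_pos (σ_pos hpos (n + 2))
      have hx : (q d (n + 1) : ℝ) / q d (n + 2) * (d (n + 1) + q d n / q d (n + 1)) = 1 := by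
        have : (q d (n + 2) : ℝ) = d (n + 1) * q d (n + 1) + q d n := by
          rw [q_add_two]; push_cast; rfl
        field_simp
        linarith
      have hx1 : (q d (n + 1) : ℝ) / q d (n + 2) ≤ 1 := by
        rw [div_le_one h2]; exact_mod_cast q_le_succ hpos (n + 1)
      have hx0 : 0 ≤ (q d (n + 1) : ℝ) / q d (n + 2) := by positivity
      set x := (q d (n + 1) : ℝ) / q d (n + 2)
      set y := (q d n : ℝ) / q d (n + 1)
      have e : x - cfValue (σ d (n + 2)) =
          -(cfValue (σ d (n + 2)) * x * (y - cfValue (σ d (n + 1)))) := by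
        push_cast at h3
        have h3' : cfValue (σ d (n + 2)) * (d (n + 1) + cfValue (σ d (n + 1))) = 1 := h3
        linear_combination cfValue (σ d (n + 2)) * hx - x * h3'
      change |x - cfValue (σ d (n + 2))| ≤ _
      rw [e, abs_neg, abs_mul, abs_mul, abs_of_pos h5, abs_of_nonneg hx0, pow_succ,
        mul_comm (ρ ^ n)]
      refine mul_le_mul ?_ ih (abs_nonneg _) hρ0
      have := hle (n + 2)
      nlinarith
  have hlim : Tendsto (fun n : ℕ => (q d n : ℝ) / q d (n + 1) - cfValue (σ d (n + 1))) atTop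
      (𝓝 0) :=
    squeeze_zero_norm hstep (tendsto_pow_atTop_nhds_zero_of_lt_one hρ0 hρ)
  have hsub : Tendsto (fun m : ℕ => m * ℓ + k - 1) atTop atTop := by
    refine tendsto_atTop_mono (f := fun m : ℕ => m - 1) (fun m => ?_) (tendsto_sub_atTop_nat 1)
    have := Nat.le_mul_of_pos_right m hℓ
    omega
  have := (hlim.comp hsub).add_const (cfValue (σ d k))
  rw [zero_add] at this
  refine this.congr' ?_
  filter_upwards [eventually_ge_atTop 1] with m hm
  have h1 : m * ℓ + k - 1 + 1 = m * ℓ + k := by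
    have := Nat.mul_pos hm hℓ
    omega
  simp only [Function.comp, h1, σ_mul hper]
  ring

lemma q_tendsto_atTop {d : ℤ → ℕ} {ℓ : ℕ} (hℓ : 1 ≤ ℓ) (hpos : ∀ i, 1 ≤ d i) (k : ℕ) :
    Tendsto (fun m : ℕ => q d (m * ℓ + k)) atTop atTop := by
  have hn (n : ℕ) : n ≤ q d (n + 1) := by
    induction n using Nat.twoStepInduction with
    | zero => simp
    | one => exact q_succ_pos hpos 1
    | more n h1 h2 =>
      have h3 : q d (n + 2) + q d (n + 1) ≤ q d (n + 2 + 1) := q_add_le hpos (n + 1)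
      have h4 := q_succ_pos hpos n
      have h5 : n + 1 ≤ q d (n + 2) := h2
      omega
  refine tendsto_atTop_mono (f := fun m : ℕ => m - 1) (fun m => ?_) (tendsto_sub_atTop_nat 1)
  have h1 := Nat.le_mul_of_pos_right m hℓ
  have h2 := monotone_nat_of_le_succ (q_le_succ hpos) (show m ≤ m * ℓ + k by omega)
  cases m with
  | zero => simp
  | succ m => exact (hn m).trans h2

/-- The limit of the scaled errors is `1 / (a_k + α_{σ_k} + [0; a_{k+1}, …])`. -/
lemma errLim_mul {d : ℤ → ℕ} {ℓ : ℕ} (hℓ : 1 ≤ ℓ) (hpos : ∀ i, 1 ≤ d i)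
    (hper : ∀ i, d (i + ℓ) = d i) (k : ℕ) :
    errLim d ℓ k * (d k + cfValue (σ d k) + tail d k) = 1 := by
  have h1 := tendsto_q_mul_err hℓ hpos hper k
  have h2 := tendsto_q_div_q hℓ hpos hper k
  refine tendsto_nhds_unique
    (h1.mul ((h2.const_add (d k : ℝ)).add_const (tail d k))) ?_
  refine tendsto_const_nhds.congr' ?_
  filter_upwards [eventually_ge_atTop 1] with m hm
  obtain ⟨n, hn⟩ : ∃ n, m * ℓ + k = n + 1 := ⟨m * ℓ + k - 1, by
    have := Nat.mul_pos hm hℓ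
    omega⟩
  have hq : (0 : ℝ) < q d (n + 1) := by exact_mod_cast q_succ_pos hpos n
  have ht : tail d k = tail d (n + 1) := by rw [tail, tail, ← hn, shift_mul hper]
  have hd : d k = d (n + 1) := by
    have : ((n : ℤ) + 1) = k + m * ℓ := by exact_mod_cast hn.symm.trans (add_comm _ _)
    rw [this, digit_add_mul hper]
  have hm := q_mul_abs_err hpos (n + 1)
  rw [abs_err_succ hpos (n + 1), q_add_two] at hm
  rw [hn, ht, hd, Nat.add_sub_cancel]
  push_cast at hm ⊢
  field_simp
  linarith

lemma errLim_pos {d : ℤ → ℕ} {ℓ : ℕ} (hℓ : 1 ≤ ℓ) (hpos : ∀ i, 1 ≤ d i)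
    (hper : ∀ i, d (i + ℓ) = d i) (k : ℕ) : 0 < errLim d ℓ k := by
  have h := errLim_mul hℓ hpos hper k
  refine lt_of_le_of_ne (show 0 ≤ errLim d ℓ k from abs_nonneg _) fun h0 => ?_
  rw [← h0] at h
  simp at h

lemma two_mul_add_one_le_u {d : ℤ → ℕ} {ℓ : ℕ} (hℓ : 1 ≤ ℓ) (hpos : ∀ i, 1 ≤ d i)
    (hper : ∀ i, d (i + ℓ) = d i) (k t : ℕ) : 2 * (t : ℝ) + 1 ≤ u d ℓ k t := by
  have h := errLim_mul hℓ hpos hper k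
  have h0 := errLim_pos hℓ hpos hper k
  have h1 : (1 : ℝ) ≤ d k := by exact_mod_cast hpos k
  have h2 := tail_pos hpos k
  have h3 := cfValue_pos (σ_pos hpos k)
  have h4 : Int.fract ((t : ℝ) * cfValue (σ d k)) ≤ t * cfValue (σ d k) := by
    have : (0 : ℝ) ≤ ⌊(t : ℝ) * cfValue (σ d k)⌋ := by
      exact_mod_cast Int.floor_nonneg.2 (by positivity)
    rw [Int.fract]; linarith
  have h5 : (t : ℝ) / errLim d ℓ k = t * (d k + cfValue (σ d k) + tail d k) := by
    rw [div_eq_iff h0.ne']; linear_combination (-(t : ℝ)) * h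
  have ht : (0 : ℝ) ≤ t := by positivity
  rw [u, ← errLim, h5]
  nlinarith [mul_nonneg ht h2.le, mul_nonneg ht (sub_nonneg.2 h1)]

/-! ### Rearranging and pairing the factors -/

/-- The scaled error `q_n |q_n α - p_n|`. -/
noncomputable def scaledErr (d : ℤ → ℕ) (n : ℕ) : ℝ := q d n * |err d n|

lemma scaledErr_pos {d : ℤ → ℕ} (hpos : ∀ i, 1 ≤ d i) {n : ℕ} (hn : 1 ≤ n) :
    0 < scaledErr d n :=
  mul_pos (by exact_mod_cast q_pos hpos hn) (abs_err_pos hpos n)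

lemma scaledErr_le_one {d : ℤ → ℕ} (hpos : ∀ i, 1 ≤ d i) (n : ℕ) : scaledErr d n ≤ 1 := by
  have h1 := q_mul_abs_err hpos n
  have h2 : (q d n : ℝ) ≤ q d (n + 1) := by exact_mod_cast q_le_succ hpos n
  have h3 := mul_le_mul_of_nonneg_right h2 (abs_nonneg (err d n))
  have h4 : (0 : ℝ) ≤ q d n * |err d (n + 1)| := by positivity
  rw [scaledErr]; linarith

lemma abs_sin_add_int_mul_pi (x : ℝ) (n : ℤ) : |Real.sin (x + n * Real.pi)| = |Real.sin x| := by
  rw [Real.sin_add_int_mul_pi, abs_mul]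
  simp

/-- With `N = n + 1`, so that `q_{N-1}` needs no subtraction: the map
`j ↦ q_N - (j q_{N-1} mod q_N)` sends `{0, …, q_N - 1}` bijectively to `{1, …, q_N}` and solves
`(-1)^{N+1} r p_N ≡ j` modulo `q_N`. -/
def reorder (d : ℤ → ℕ) (n j : ℕ) : ℕ := q d (n + 1) - (j * q d n) % q d (n + 1)

lemma reorder_mem {d : ℤ → ℕ} (hpos : ∀ i, 1 ≤ d i) (n j : ℕ) :
    reorder d n j ∈ Finset.Icc 1 (q d (n + 1)) := by
  have := Nat.mod_lt (j * q d n) (q_succ_pos hpos n)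
  rw [reorder, Finset.mem_Icc]; omega

lemma coprime_q (d : ℤ → ℕ) (n : ℕ) : Nat.Coprime (q d n) (q d (n + 1)) := by
  have h := p_mul_q_sub d n
  rw [← Nat.isCoprime_iff_coprime]
  refine ⟨(-1) ^ (n + 1) * p d (n + 1), -((-1) ^ (n + 1) * p d n), ?_⟩
  have hs : ((-1 : ℤ) ^ (n + 1)) * (-1) ^ (n + 1) = 1 := by
    rw [← mul_pow]; norm_num
  linear_combination ((-1 : ℤ) ^ (n + 1)) * h + hs

lemma reorder_injOn {d : ℤ → ℕ} (hpos : ∀ i, 1 ≤ d i) (n : ℕ) :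
    Set.InjOn (reorder d n) (Finset.range (q d (n + 1)) : Set ℕ) := by
  intro i hi j hj hij
  have h1 := Nat.mod_lt (i * q d n) (q_succ_pos hpos n)
  have h2 := Nat.mod_lt (j * q d n) (q_succ_pos hpos n)
  simp only [reorder] at hij
  have h3 : i * q d n ≡ j * q d n [MOD q d (n + 1)] := by
    rw [Nat.ModEq]; omega
  have h4 := Nat.ModEq.cancel_right_of_coprime (coprime_q d n).symm h3
  exact h4.eq_of_lt_of_lt (Finset.mem_range.1 hi) (Finset.mem_range.1 hj)

lemma prod_reorder {d : ℤ → ℕ} (hpos : ∀ i, 1 ≤ d i) (n : ℕ) (f : ℕ → ℝ) :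
    ∏ r ∈ Finset.Icc 1 (q d (n + 1)), f r =
      ∏ j ∈ Finset.range (q d (n + 1)), f (reorder d n j) := by
  rw [← Finset.prod_image (s := Finset.range (q d (n + 1))) (reorder_injOn hpos n)]
  congr 1
  refine (Finset.eq_of_subset_of_card_le ?_ ?_).symm
  · intro r hr
    obtain ⟨j, -, rfl⟩ := Finset.mem_image.1 hr
    exact reorder_mem hpos n j
  · rw [Finset.card_image_of_injOn (reorder_injOn hpos n)]
    simp

/-- The quotient `r / q_N` for `N = n + 1` and `r = reorder d n j`. In units of `1 / q_N`, it is the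
displacement of the `j`-th point from the integer `j`, divided by the scaled error. -/
noncomputable def offset (d : ℤ → ℕ) (n j : ℕ) : ℝ :=
  1 - Int.fract ((j : ℝ) * ((q d n : ℝ) / q d (n + 1)))

lemma reorder_eq {d : ℤ → ℕ} (hpos : ∀ i, 1 ≤ d i) (n j : ℕ) :
    (reorder d n j : ℝ) = q d (n + 1) * offset d n j := by
  have hq : (0 : ℝ) < q d (n + 1) := by exact_mod_cast q_succ_pos hpos n
  have h1 := Nat.mod_lt (j * q d n) (q_succ_pos hpos n)
  have h2 : (j : ℝ) * ((q d n : ℝ) / q d (n + 1)) = ((j * q d n : ℕ) : ℝ) / (q d (n + 1) : ℕ) := by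
    push_cast; ring
  rw [offset, h2, Int.fract_div_natCast_eq_div_natCast_mod, reorder, Nat.cast_sub h1.le]
  field_simp

lemma reorder_mul_p (d : ℤ → ℕ) {n : ℕ} (hpos : ∀ i, 1 ≤ d i) (j : ℕ) :
    ∃ z : ℤ, (reorder d n j : ℤ) * p d (n + 1) = (-1) ^ (n + 2) * j + z * q d (n + 1) := by
  have h1 := Nat.mod_lt (j * q d n) (q_succ_pos hpos n)
  have h2 : ((j * q d n : ℕ) : ℤ) = q d (n + 1) * ((j * q d n / q d (n + 1) : ℕ) : ℤ) +
      ((j * q d n % q d (n + 1) : ℕ) : ℤ) := by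
    exact_mod_cast (Nat.div_add_mod (j * q d n) (q d (n + 1))).symm
  have h3 := p_mul_q_sub d n
  refine ⟨p d (n + 1) * (1 + ((j * q d n / q d (n + 1) : ℕ) : ℤ)) - j * p d n, ?_⟩
  rw [reorder, Nat.cast_sub h1.le, pow_succ]
  push_cast at h2 ⊢
  linear_combination (p d (n + 1) : ℤ) * h2 - (j : ℤ) * h3

lemma abs_sin_reorder {d : ℤ → ℕ} (hpos : ∀ i, 1 ≤ d i) (n j : ℕ) (ε : ℝ) :
    |Real.sin (Real.pi * (reorder d n j * cfValue d
        + (-1) ^ (n + 1 + 1) * (ε / (q d (n + 1) : ℝ))))| =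
      |Real.sin (Real.pi * (j + ε + scaledErr d (n + 1) * offset d n j) / q d (n + 1))| := by
  have hq : (0 : ℝ) < q d (n + 1) := by exact_mod_cast q_succ_pos hpos n
  obtain ⟨z, hz⟩ := reorder_mul_p d hpos (n := n) j
  have hz' : (reorder d n j : ℝ) * p d (n + 1) = (-1) ^ (n + 2) * j + z * q d (n + 1) := by
    exact_mod_cast hz
  have hr := reorder_eq hpos n j
  have he := (err_eq_sign_mul_and_ne_zero hpos (n + 1)).1
  have hα : (q d (n + 1) : ℝ) * cfValue d = p d (n + 1) + (-1) ^ (n + 2) * |err d (n + 1)| := by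
    rw [← he, err]; ring
  have key : Real.pi * (reorder d n j * cfValue d + (-1) ^ (n + 1 + 1) * (ε / (q d (n + 1) : ℝ))) =
      (-1) ^ (n + 2) * (Real.pi * (j + ε + scaledErr d (n + 1) * offset d n j) / q d (n + 1))
        + z * Real.pi := by
    have : (reorder d n j : ℝ) * cfValue d = ((-1) ^ (n + 2) * j + z * q d (n + 1)
        + (-1) ^ (n + 2) * (reorder d n j * |err d (n + 1)|)) / q d (n + 1) := by
      rw [eq_div_iff hq.ne']
      linear_combination (reorder d n j : ℝ) * hα + hz'
    rw [this, hr, scaledErr]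
    field_simp
    ring
  rw [key, abs_sin_add_int_mul_pi]
  rcases neg_one_pow_eq_or ℝ (n + 2) with h | h <;> rw [h]
  · rw [one_mul]
  · rw [neg_one_mul, Real.sin_neg, abs_neg]

lemma perturbedSudler_eq_prod {d : ℤ → ℕ} (hpos : ∀ i, 1 ≤ d i) (n : ℕ) (ε : ℝ) :
    perturbedSudler d (n + 1) ε = ∏ j ∈ Finset.range (q d (n + 1)), 2 *
      |Real.sin (Real.pi * (j + ε + scaledErr d (n + 1) * offset d n j) / q d (n + 1))| := by
  rw [perturbedSudler, prod_reorder hpos]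
  exact Finset.prod_congr rfl fun j _ => by rw [abs_sin_reorder hpos]

/-- The midpoint, in units of `1 / q_N` with `N = n + 1`, of the `j`-th point and the mirror image
of the `(q_N - j)`-th point. -/
noncomputable def centre (d : ℤ → ℕ) (n j : ℕ) : ℝ :=
  j - scaledErr d (n + 1) * (1 / 2 - offset d n j)

lemma offset_reflect {d : ℤ → ℕ} (hpos : ∀ i, 1 ≤ d i) (n : ℕ) {j : ℕ}
    (hj : j ∈ Finset.Ico 1 (q d (n + 1))) :
    offset d n (q d (n + 1) - j) = 1 - offset d n j := by
  have hq : (0 : ℝ) < q d (n + 1) := by exact_mod_cast q_succ_pos hpos n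
  obtain ⟨h1, h2⟩ := Finset.mem_Ico.1 hj
  have hne : Int.fract ((j : ℝ) * ((q d n : ℝ) / q d (n + 1))) ≠ 0 := by
    have e : (j : ℝ) * ((q d n : ℝ) / q d (n + 1)) = ((j * q d n : ℕ) : ℝ) / (q d (n + 1) : ℕ) := by
      push_cast; ring
    rw [e, Int.fract_div_natCast_eq_div_natCast_mod, div_ne_zero_iff]
    refine ⟨?_, hq.ne'⟩
    rw [Nat.cast_ne_zero, ← Nat.pos_iff_ne_zero, Nat.pos_iff_ne_zero]
    intro h0
    have h3 := (coprime_q d n).symm.dvd_of_dvd_mul_right (Nat.dvd_of_mod_eq_zero h0)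
    exact absurd (Nat.le_of_dvd h1 h3) (not_le.2 h2)
  have e : ((q d (n + 1) - j : ℕ) : ℝ) * ((q d n : ℝ) / q d (n + 1)) =
      -((j : ℝ) * ((q d n : ℝ) / q d (n + 1))) + (q d n : ℤ) := by
    rw [Nat.cast_sub h2.le]; push_cast; field_simp; ring
  rw [offset, offset, e, Int.fract_add_intCast, Int.fract_neg hne]

lemma centre_reflect {d : ℤ → ℕ} (hpos : ∀ i, 1 ≤ d i) (n : ℕ) {j : ℕ}
    (hj : j ∈ Finset.Ico 1 (q d (n + 1))) :
    centre d n (q d (n + 1) - j) = q d (n + 1) - centre d n j := by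
  rw [centre, centre, offset_reflect hpos n hj, Nat.cast_sub (Finset.mem_Ico.1 hj).2.le]
  ring

lemma abs_centre_sub_le {d : ℤ → ℕ} (hpos : ∀ i, 1 ≤ d i) (n j : ℕ) :
    |centre d n j - j| ≤ 1 / 2 := by
  have h1 := Int.fract_nonneg ((j : ℝ) * ((q d n : ℝ) / q d (n + 1)))
  have h2 := (Int.fract_lt_one ((j : ℝ) * ((q d n : ℝ) / q d (n + 1)))).le
  have h3 := scaledErr_le_one hpos (n + 1)
  have h4 := (scaledErr_pos hpos (Nat.succ_pos n)).le
  rw [centre, offset, abs_le]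
  constructor <;> nlinarith

/-- The product of the `j`-th and the `(q_N - j)`-th factor, where `N = n + 1`. -/
noncomputable def pairFactor (d : ℤ → ℕ) (n : ℕ) (ε : ℝ) (j : ℕ) : ℝ :=
  4 * |Real.sin (Real.pi * centre d n j / q d (n + 1)) ^ 2
    - Real.sin (Real.pi * (ε + scaledErr d (n + 1) / 2) / q d (n + 1)) ^ 2|

lemma sin_sq_sub_sin_sq (x y : ℝ) :
    Real.sin x ^ 2 - Real.sin y ^ 2 = Real.sin (x + y) * Real.sin (x - y) := by
  rw [Real.sin_add, Real.sin_sub]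
  linear_combination (-Real.sin x ^ 2) * Real.sin_sq_add_cos_sq y
    + Real.sin y ^ 2 * Real.sin_sq_add_cos_sq x

lemma pairFactor_eq {d : ℤ → ℕ} (hpos : ∀ i, 1 ≤ d i) (n : ℕ) (ε : ℝ) {j : ℕ}
    (hj : j ∈ Finset.Ico 1 (q d (n + 1))) :
    (2 * |Real.sin (Real.pi * (j + ε + scaledErr d (n + 1) * offset d n j) / q d (n + 1))|) *
      (2 * |Real.sin (Real.pi * ((q d (n + 1) - j : ℕ) + ε
        + scaledErr d (n + 1) * offset d n (q d (n + 1) - j)) / q d (n + 1))|) =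
      pairFactor d n ε j := by
  have hq : (0 : ℝ) < q d (n + 1) := by exact_mod_cast q_succ_pos hpos n
  rw [pairFactor, sin_sq_sub_sin_sq, abs_mul, offset_reflect hpos n hj,
    Nat.cast_sub (Finset.mem_Ico.1 hj).2.le]
  have e1 : Real.pi * (j + ε + scaledErr d (n + 1) * offset d n j) / q d (n + 1) =
      Real.pi * centre d n j / q d (n + 1) +
        Real.pi * (ε + scaledErr d (n + 1) / 2) / q d (n + 1) := by
    rw [centre]; ring
  have e2 : Real.pi * ((q d (n + 1) - j : ℝ) + ε + scaledErr d (n + 1) * (1 - offset d n j))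
      / q d (n + 1) = Real.pi - (Real.pi * centre d n j / q d (n + 1) -
        Real.pi * (ε + scaledErr d (n + 1) / 2) / q d (n + 1)) := by
    rw [centre]; field_simp; ring
  rw [e1, e2, Real.sin_pi_sub]
  ring

lemma pairFactor_reflect {d : ℤ → ℕ} (hpos : ∀ i, 1 ≤ d i) (n : ℕ) (ε : ℝ) {j : ℕ}
    (hj : j ∈ Finset.Ico 1 (q d (n + 1))) :
    pairFactor d n ε (q d (n + 1) - j) = pairFactor d n ε j := by
  have hq : (0 : ℝ) < q d (n + 1) := by exact_mod_cast q_succ_pos hpos n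
  have e : Real.pi * (q d (n + 1) - centre d n j) / q d (n + 1) =
      Real.pi - Real.pi * centre d n j / q d (n + 1) := by field_simp
  rw [pairFactor, centre_reflect hpos n hj, e, Real.sin_pi_sub, pairFactor]

/-- A product of a symmetric function over `0 < j < N` splits into two initial segments. -/
lemma prod_Ico_symm (N : ℕ) (hN : 1 ≤ N) (f : ℕ → ℝ)
    (hf : ∀ j ∈ Finset.Ico 1 N, f (N - j) = f j) :
    ∏ j ∈ Finset.Ico 1 N, f j =
      (∏ t ∈ Finset.range (N / 2), f (t + 1)) * ∏ t ∈ Finset.range (N - 1 - N / 2), f (t + 1) := by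
  have h1 : ∏ t ∈ Finset.range (N / 2), f (t + 1) = ∏ j ∈ Finset.Ico 1 (N / 2 + 1), f j := by
    rw [Finset.prod_Ico_eq_prod_range]
    exact Finset.prod_congr (by simp) fun t _ => by rw [add_comm]
  have h2 : ∏ t ∈ Finset.range (N - 1 - N / 2), f (t + 1) =
      ∏ j ∈ Finset.Ico 1 (N - N / 2), f j := by
    rw [Finset.prod_Ico_eq_prod_range]
    refine Finset.prod_congr (by congr 1; omega) fun t _ => by rw [add_comm]
  have h3 : ∏ j ∈ Finset.Ico (N / 2 + 1) N, f j = ∏ j ∈ Finset.Ico 1 (N - N / 2), f j := by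
    have h := Finset.prod_Ico_reflect f 1 (m := N - N / 2) (n := N) (by omega)
    rw [show N + 1 - (N - N / 2) = N / 2 + 1 by omega, show N + 1 - 1 = N by omega] at h
    rw [← h]
    refine Finset.prod_congr rfl fun j hj => hf j ?_
    rw [Finset.mem_Ico] at hj ⊢
    omega
  rw [h1, h2, ← h3, Finset.prod_Ico_consecutive _ (by omega) (by omega)]

lemma perturbedSudler_sq {d : ℤ → ℕ} (hpos : ∀ i, 1 ≤ d i) (n : ℕ) (ε : ℝ) :
    perturbedSudler d (n + 1) ε ^ 2 =
      (2 * Real.sin (Real.pi * (ε + scaledErr d (n + 1)) / q d (n + 1))) ^ 2 *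
        ((∏ t ∈ Finset.range (q d (n + 1) / 2), pairFactor d n ε (t + 1)) *
          ∏ t ∈ Finset.range (q d (n + 1) - 1 - q d (n + 1) / 2), pairFactor d n ε (t + 1)) := by
  have hq := q_succ_pos hpos n
  rw [← prod_Ico_symm _ hq _ fun j hj => pairFactor_reflect hpos n ε hj,
    perturbedSudler_eq_prod hpos, ← Finset.prod_range_mul_prod_Ico _ (show 1 ≤ q d (n + 1) from hq),
    mul_pow]
  congr 1
  · simp [offset, mul_pow]
  · have h := Finset.prod_Ico_reflect (fun j : ℕ => 2 * |Real.sin (Real.pi * (j + ε +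
      scaledErr d (n + 1) * offset d n j) / q d (n + 1))|) 1 (m := q d (n + 1)) (n := q d (n + 1))
      (by omega)
    rw [show q d (n + 1) + 1 - q d (n + 1) = 1 by omega, Nat.add_sub_cancel] at h
    rw [sq]
    nth_rewrite 2 [← h]
    rw [← Finset.prod_mul_distrib]
    exact Finset.prod_congr rfl fun j hj => pairFactor_eq hpos n ε hj

/-! ### The limit of the quotients of perturbed products -/

/-- The range exceeds `[0, π / 2]` because a centre may lie slightly beyond `q_N / 2`. -/
lemma div_five_le_sin {x : ℝ} (h0 : 0 ≤ x) (h1 : x ≤ 3 * Real.pi / 4) : x / 5 ≤ Real.sin x := by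
  have hpi := Real.pi_pos
  have hpi4 := Real.pi_lt_d2
  rcases le_total x (Real.pi / 2) with h | h
  · have h2 := Real.mul_le_sin h0 h
    have h3 : x / 5 ≤ 2 / Real.pi * x := by
      rw [div_mul_eq_mul_div, div_le_div_iff₀ (by norm_num) hpi]
      nlinarith
    exact h3.trans h2
  · have h2 := Real.mul_le_sin (x := Real.pi - x) (by linarith) (by linarith)
    rw [Real.sin_pi_sub] at h2
    have h3 : 1 / 2 ≤ 2 / Real.pi * (Real.pi - x) := by
      rw [div_mul_eq_mul_div, div_le_div_iff₀ (by norm_num) hpi]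
      nlinarith
    have : x / 5 ≤ 1 / 2 := by linarith
    linarith

lemma le_abs_sin_centre {d : ℤ → ℕ} (hpos : ∀ i, 1 ≤ d i) {n j : ℕ} (hj : 1 ≤ j)
    (hjq : j ≤ q d (n + 1) / 2) :
    Real.pi * j / (10 * q d (n + 1)) ≤ Real.sin (Real.pi * centre d n j / q d (n + 1)) := by
  have hq : (0 : ℝ) < q d (n + 1) := by exact_mod_cast q_succ_pos hpos n
  have hpi := Real.pi_pos
  have h1 := abs_le.1 (abs_centre_sub_le hpos n j)
  have h2 : (1 : ℝ) ≤ j := by exact_mod_cast hj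
  have h3 : (j : ℝ) * 2 ≤ q d (n + 1) := by
    exact_mod_cast (Nat.le_div_iff_mul_le two_pos).1 hjq
  have h4 : Real.pi * centre d n j / q d (n + 1) ≤ 3 * Real.pi / 4 := by
    rw [div_le_div_iff₀ hq (by norm_num)]
    have : centre d n j * 4 ≤ 3 * q d (n + 1) := by linarith
    nlinarith
  have h5 : 0 ≤ Real.pi * centre d n j / q d (n + 1) :=
    div_nonneg (mul_nonneg hpi.le (by linarith)) hq.le
  refine le_trans ?_ (div_five_le_sin h5 h4)
  rw [div_div, div_le_div_iff₀ (by positivity) (by positivity)]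
  have : (j : ℝ) ≤ 2 * centre d n j := by linarith
  have h6 := mul_le_mul_of_nonneg_left this (show 0 ≤ Real.pi * (5 * q d (n + 1)) by positivity)
  nlinarith

/-- The relative deviation of the `(t+1)`-st paired factor from its main part. -/
noncomputable def pairDev (d : ℤ → ℕ) (n : ℕ) (ε : ℝ) (t : ℕ) : ℝ :=
  -(Real.sin (Real.pi * (ε + scaledErr d (n + 1) / 2) / q d (n + 1))
    / Real.sin (Real.pi * centre d n (t + 1) / q d (n + 1))) ^ 2

lemma sin_centre_pos {d : ℤ → ℕ} (hpos : ∀ i, 1 ≤ d i) {n t : ℕ}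
    (ht : t + 1 ≤ q d (n + 1) / 2) :
    0 < Real.sin (Real.pi * centre d n (t + 1) / q d (n + 1)) := by
  have hq : (0 : ℝ) < q d (n + 1) := by exact_mod_cast q_succ_pos hpos n
  have hpi := Real.pi_pos
  exact lt_of_lt_of_le (by positivity) (le_abs_sin_centre hpos (Nat.le_add_left 1 t) ht)

lemma pairFactor_eq_mul {d : ℤ → ℕ} (hpos : ∀ i, 1 ≤ d i) {n : ℕ} (ε : ℝ) {t : ℕ}
    (ht : t + 1 ≤ q d (n + 1) / 2) :
    pairFactor d n ε (t + 1) =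
      (2 * Real.sin (Real.pi * centre d n (t + 1) / q d (n + 1))) ^ 2 * |1 + pairDev d n ε t| := by
  have h := sin_centre_pos hpos ht
  have e (x : ℝ) : Real.sin (Real.pi * centre d n (t + 1) / q d (n + 1)) ^ 2 - x ^ 2 =
      Real.sin (Real.pi * centre d n (t + 1) / q d (n + 1)) ^ 2 *
        (1 + -(x / Real.sin (Real.pi * centre d n (t + 1) / q d (n + 1))) ^ 2) := by
    field_simp
    ring
  rw [pairFactor, e, abs_mul, abs_of_nonneg (sq_nonneg (Real.sin _)), pairDev]
  ring

lemma abs_pairDev_le {d : ℤ → ℕ} (hpos : ∀ i, 1 ≤ d i) {n : ℕ} {ε Y : ℝ}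
    (hY : |ε| + 1 ≤ Y) {t : ℕ} (ht : t + 1 ≤ q d (n + 1) / 2) :
    |pairDev d n ε t| ≤ 100 * Y ^ 2 / ((t : ℝ) + 1) ^ 2 := by
  have hq : (0 : ℝ) < q d (n + 1) := by exact_mod_cast q_succ_pos hpos n
  have hpi := Real.pi_pos
  have h1 := le_abs_sin_centre hpos (Nat.le_add_left 1 t) ht
  have h2 : |Real.sin (Real.pi * (ε + scaledErr d (n + 1) / 2) / q d (n + 1))| ≤
      Real.pi * Y / q d (n + 1) := by
    refine (Real.abs_sin_le_abs).trans ?_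
    rw [abs_div, abs_mul, abs_of_pos hpi, abs_of_pos hq]
    have h3 := scaledErr_le_one hpos (n + 1)
    have h4 := scaledErr_pos hpos (Nat.succ_pos n)
    have : |ε + scaledErr d (n + 1) / 2| ≤ Y := by
      refine (abs_add_le _ _).trans ?_
      rw [abs_of_pos (show 0 < scaledErr d (n + 1) / 2 by linarith)]
      linarith
    gcongr
  have hs : 0 < Real.pi * ((t + 1 : ℕ) : ℝ) / (10 * q d (n + 1)) := by positivity
  rw [pairDev, abs_neg, abs_pow, abs_div, abs_of_pos (hs.trans_le h1)]
  have h5 : |Real.sin (Real.pi * (ε + scaledErr d (n + 1) / 2) / q d (n + 1))| /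
      Real.sin (Real.pi * centre d n (t + 1) / q d (n + 1)) ≤ 10 * Y / ((t : ℝ) + 1) := by
    refine (div_le_div₀ (h2.trans' (abs_nonneg _)) h2 hs h1).trans (le_of_eq ?_)
    push_cast
    field_simp
  calc _ ≤ (10 * Y / ((t : ℝ) + 1)) ^ 2 := by
        gcongr
        exact div_nonneg (abs_nonneg _) (hs.trans_le h1).le
    _ = _ := by rw [div_pow]; ring

/-- If `x → X` and `N → ∞` then `N sin (π x / N) → π X`. -/
lemma tendsto_mul_sin {ι : Type*} {l : Filter ι} {x : ι → ℝ} {N : ι → ℕ} {X : ℝ}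
    (hx : Tendsto x l (𝓝 X)) (hN : Tendsto N l atTop) :
    Tendsto (fun i => (N i : ℝ) * Real.sin (Real.pi * x i / N i)) l (𝓝 (Real.pi * X)) := by
  have hN' : Tendsto (fun i => (N i : ℝ)) l atTop := tendsto_natCast_atTop_atTop.comp hN
  have h1 : Tendsto (fun i => Real.pi * x i / N i) l (𝓝 0) :=
    (hx.const_mul Real.pi).div_atTop hN'
  have h2 := (Real.continuous_sinc.tendsto 0).comp h1
  rw [Real.sinc_zero] at h2
  have h3 := (hx.const_mul Real.pi).mul h2
  rw [mul_one] at h3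
  refine h3.congr' ?_
  filter_upwards [hN.eventually_ge_atTop 1] with i hi
  have hi' : (0 : ℝ) < N i := by exact_mod_cast hi
  rcases eq_or_ne (Real.pi * x i / N i) 0 with h | h
  · have : Real.pi * x i = 0 := by
      rcases div_eq_zero_iff.1 h with h | h
      · exact h
      · exact absurd h hi'.ne'
    simp [this]
  · simp only [Function.comp, Real.sinc_of_ne_zero h]
    have hx0 : x i ≠ 0 := fun h0 => h (by rw [h0, mul_zero, zero_div])
    field_simp

lemma tendsto_fract_mul {ι : Type*} {l : Filter ι} {x : ι → ℝ} {θ : ℝ} (hθ : Irrational θ)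
    (hx : Tendsto x l (𝓝 θ)) (t : ℕ) :
    Tendsto (fun i => Int.fract (((t + 1 : ℕ) : ℝ) * x i)) l
      (𝓝 (Int.fract (((t + 1 : ℕ) : ℝ) * θ))) := by
  have hne : ((⌊((t + 1 : ℕ) : ℝ) * θ⌋ : ℤ) : ℝ) ≠ ((t + 1 : ℕ) : ℝ) * θ := by
    intro h
    exact (hθ.natCast_mul (Nat.succ_ne_zero t)).ne_int _ h.symm
  exact ((continuousAt_fract hne.symm).tendsto).comp (hx.const_mul _)

lemma tendsto_offset {d : ℤ → ℕ} {ℓ : ℕ} (hℓ : 1 ≤ ℓ) (hpos : ∀ i, 1 ≤ d i)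
    (hper : ∀ i, d (i + ℓ) = d i) (k t : ℕ) :
    Tendsto (fun m : ℕ => offset d (m * ℓ + k) (t + 1)) atTop
      (𝓝 (1 - Int.fract (((t + 1 : ℕ) : ℝ) * cfValue (σ d (k + 1))))) :=
  (tendsto_fract_mul (cfValue_irrational (σ_pos hpos _))
    (tendsto_q_div_q hℓ hpos hper (k + 1)) t).const_sub 1

lemma tendsto_scaledErr {d : ℤ → ℕ} {ℓ : ℕ} (hℓ : 1 ≤ ℓ) (hpos : ∀ i, 1 ≤ d i)
    (hper : ∀ i, d (i + ℓ) = d i) (k : ℕ) :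
    Tendsto (fun m : ℕ => scaledErr d (m * ℓ + k)) atTop (𝓝 (errLim d ℓ k)) :=
  tendsto_q_mul_err hℓ hpos hper k

lemma tendsto_centre {d : ℤ → ℕ} {ℓ : ℕ} (hℓ : 1 ≤ ℓ) (hpos : ∀ i, 1 ≤ d i)
    (hper : ∀ i, d (i + ℓ) = d i) (k t : ℕ) :
    Tendsto (fun m : ℕ => centre d (m * ℓ + k) (t + 1)) atTop
      (𝓝 (errLim d ℓ (k + 1) * u d ℓ (k + 1) (t + 1) / 2)) := by
  have h := ((tendsto_scaledErr hℓ hpos hper (k + 1)).mul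
    ((tendsto_offset hℓ hpos hper k t).const_sub (1 / 2))).const_sub ((t + 1 : ℕ) : ℝ)
  have h0 := (errLim_pos hℓ hpos hper (k + 1)).ne'
  have e : errLim d ℓ (k + 1) * u d ℓ (k + 1) (t + 1) / 2 = ((t + 1 : ℕ) : ℝ) -
      errLim d ℓ (k + 1) *
        (1 / 2 - (1 - Int.fract (((t + 1 : ℕ) : ℝ) * cfValue (σ d (k + 1))))) := by
    rw [u, ← errLim]
    field_simp
    ring
  rw [e]
  exact h

/-- The limit of the paired factors with perturbation parameter `y = 1 + 2 ε / λ`, where `λ` is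
the limit of the scaled errors. -/
noncomputable def limProd (d : ℤ → ℕ) (ℓ k : ℕ) (y : ℝ) : ℝ :=
  ∏' t : ℕ, |1 - y ^ 2 / u d ℓ k (t + 1) ^ 2|

lemma add_one_le_u {d : ℤ → ℕ} {ℓ : ℕ} (hℓ : 1 ≤ ℓ) (hpos : ∀ i, 1 ≤ d i)
    (hper : ∀ i, d (i + ℓ) = d i) (k t : ℕ) : (t : ℝ) + 1 ≤ u d ℓ k (t + 1) := by
  have h := two_mul_add_one_le_u hℓ hpos hper k (t + 1)
  have : (0 : ℝ) ≤ t := by positivity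
  push_cast at h
  linarith

lemma summable_inv_sq : Summable fun t : ℕ => 1 / ((t : ℝ) + 1) ^ 2 := by
  have h := (summable_nat_add_iff 1).2 (Real.summable_one_div_nat_pow.2 one_lt_two)
  simpa using h

lemma summable_div_u_sq {d : ℤ → ℕ} {ℓ : ℕ} (hℓ : 1 ≤ ℓ) (hpos : ∀ i, 1 ≤ d i)
    (hper : ∀ i, d (i + ℓ) = d i) (k : ℕ) (y : ℝ) :
    Summable fun t : ℕ => ‖-(y ^ 2 / u d ℓ k (t + 1) ^ 2)‖ := by
  refine Summable.of_nonneg_of_le (fun _ => norm_nonneg _) (fun t => ?_)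
    (summable_inv_sq.mul_left (y ^ 2))
  have h := add_one_le_u hℓ hpos hper k t
  have ht : (0 : ℝ) < (t : ℝ) + 1 := by positivity
  rw [norm_neg, Real.norm_of_nonneg (by positivity), mul_one_div]
  gcongr

lemma multipliable_sub {d : ℤ → ℕ} {ℓ : ℕ} (hℓ : 1 ≤ ℓ) (hpos : ∀ i, 1 ≤ d i)
    (hper : ∀ i, d (i + ℓ) = d i) (k : ℕ) (y : ℝ) :
    Multipliable fun t : ℕ => 1 + -(y ^ 2 / u d ℓ k (t + 1) ^ 2) :=
  multipliable_one_add_of_summable (summable_div_u_sq hℓ hpos hper k y)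

lemma limProd_eq_abs {d : ℤ → ℕ} {ℓ : ℕ} (hℓ : 1 ≤ ℓ) (hpos : ∀ i, 1 ≤ d i)
    (hper : ∀ i, d (i + ℓ) = d i) (k : ℕ) (y : ℝ) :
    limProd d ℓ k y = |∏' t : ℕ, (1 + -(y ^ 2 / u d ℓ k (t + 1) ^ 2))| := by
  have h := (multipliable_sub hℓ hpos hper k y).norm_tprod
  simp only [Real.norm_eq_abs, ← sub_eq_add_neg] at h ⊢
  exact h.symm

lemma hasProd_limProd {d : ℤ → ℕ} {ℓ : ℕ} (hℓ : 1 ≤ ℓ) (hpos : ∀ i, 1 ≤ d i)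
    (hper : ∀ i, d (i + ℓ) = d i) (k : ℕ) (y : ℝ) :
    HasProd (fun t : ℕ => |1 - y ^ 2 / u d ℓ k (t + 1) ^ 2|) (limProd d ℓ k y) := by
  have h := (multipliable_sub hℓ hpos hper k y).norm
  simp only [Real.norm_eq_abs, ← sub_eq_add_neg] at h
  exact h.hasProd

lemma limProd_pos {d : ℤ → ℕ} {ℓ : ℕ} (hℓ : 1 ≤ ℓ) (hpos : ∀ i, 1 ≤ d i)
    (hper : ∀ i, d (i + ℓ) = d i) (k : ℕ) {y : ℝ}
    (hy : ∀ t : ℕ, 1 - y ^ 2 / u d ℓ k (t + 1) ^ 2 ≠ 0) : 0 < limProd d ℓ k y := by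
  rw [limProd_eq_abs hℓ hpos hper]
  exact abs_pos.2 (tprod_one_add_ne_zero_of_summable
    (f := fun t : ℕ => -(y ^ 2 / u d ℓ k (t + 1) ^ 2))
    (fun t => by rw [← sub_eq_add_neg]; exact hy t) (summable_div_u_sq hℓ hpos hper k y))

lemma one_sub_inv_u_sq_pos {d : ℤ → ℕ} {ℓ : ℕ} (hℓ : 1 ≤ ℓ) (hpos : ∀ i, 1 ≤ d i)
    (hper : ∀ i, d (i + ℓ) = d i) (k t : ℕ) : 0 < 1 - 1 / u d ℓ k (t + 1) ^ 2 := by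
  have h := two_mul_add_one_le_u hℓ hpos hper k (t + 1)
  have ht : (0 : ℝ) ≤ t := by positivity
  push_cast at h
  have h1 : 1 < u d ℓ k (t + 1) := by linarith
  rw [sub_pos, div_lt_one (by positivity)]
  nlinarith

lemma limProd_one_pos {d : ℤ → ℕ} {ℓ : ℕ} (hℓ : 1 ≤ ℓ) (hpos : ∀ i, 1 ≤ d i)
    (hper : ∀ i, d (i + ℓ) = d i) (k : ℕ) : 0 < limProd d ℓ k 1 :=
  limProd_pos hℓ hpos hper k fun t => by
    rw [one_pow]; exact (one_sub_inv_u_sq_pos hℓ hpos hper k t).ne'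

lemma tendsto_pairDev {d : ℤ → ℕ} {ℓ : ℕ} (hℓ : 1 ≤ ℓ) (hpos : ∀ i, 1 ≤ d i)
    (hper : ∀ i, d (i + ℓ) = d i) (k : ℕ) (ε : ℝ) (t : ℕ) :
    Tendsto (fun z : ℕ × ℝ => pairDev d (z.1 * ℓ + k) z.2 t) (atTop ×ˢ 𝓝 ε)
      (𝓝 (-((1 + 2 * ε / errLim d ℓ (k + 1)) ^ 2 / u d ℓ (k + 1) (t + 1) ^ 2))) := by
  have hN : Tendsto (fun z : ℕ × ℝ => q d (z.1 * ℓ + k + 1)) (atTop ×ˢ 𝓝 ε) atTop :=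
    (q_tendsto_atTop hℓ hpos (k + 1)).comp tendsto_fst
  have h1 := tendsto_mul_sin (tendsto_snd.add
    (((tendsto_scaledErr hℓ hpos hper (k + 1)).comp
      (tendsto_fst (f := atTop) (g := 𝓝 ε))).div_const 2)) hN
  have h2 := tendsto_mul_sin ((tendsto_centre hℓ hpos hper k t).comp
    (tendsto_fst (f := atTop) (g := 𝓝 ε))) hN
  have hΛ := errLim_pos hℓ hpos hper (k + 1)
  have hu : 0 < u d ℓ (k + 1) (t + 1) :=
    lt_of_lt_of_le (by positivity) (add_one_le_u hℓ hpos hper (k + 1) t)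
  have hpi := Real.pi_pos
  have h3 := ((h1.div h2 (by positivity)).pow 2).neg
  have e : -((1 + 2 * ε / errLim d ℓ (k + 1)) ^ 2 / u d ℓ (k + 1) (t + 1) ^ 2) =
      -(Real.pi * (ε + errLim d ℓ (k + 1) / 2) /
        (Real.pi * (errLim d ℓ (k + 1) * u d ℓ (k + 1) (t + 1) / 2))) ^ 2 := by
    field_simp
    ring
  rw [e]
  refine h3.congr fun z => ?_
  have hq : (0 : ℝ) < q d (z.1 * ℓ + k + 1) := by exact_mod_cast q_succ_pos hpos _
  rw [pairDev]
  simp only [Pi.div_apply, Function.comp]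
  rw [mul_div_mul_left _ _ hq.ne']
  rfl

/-- Dominated convergence for the initial segments of the paired product. -/
lemma tendsto_prod_pairDev {d : ℤ → ℕ} {ℓ : ℕ} (hℓ : 1 ≤ ℓ) (hpos : ∀ i, 1 ≤ d i)
    (hper : ∀ i, d (i + ℓ) = d i) (k : ℕ) (ε : ℝ) {h : ℕ → ℕ} (htop : Tendsto h atTop atTop)
    (hle : ∀ m, h m ≤ q d (m * ℓ + k + 1) / 2) :
    Tendsto (fun z : ℕ × ℝ => ∏ t ∈ Finset.range (h z.1), |1 + pairDev d (z.1 * ℓ + k) z.2 t|)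
      (atTop ×ˢ 𝓝 ε) (𝓝 (limProd d ℓ (k + 1) (1 + 2 * ε / errLim d ℓ (k + 1)))) := by
  have key : Tendsto (fun z : ℕ × ℝ => ∏' t : ℕ,
      (1 + if t < h z.1 then pairDev d (z.1 * ℓ + k) z.2 t else 0)) (atTop ×ˢ 𝓝 ε)
      (𝓝 (∏' t : ℕ, (1 + -((1 + 2 * ε / errLim d ℓ (k + 1)) ^ 2 /
        u d ℓ (k + 1) (t + 1) ^ 2)))) := by
    refine tendsto_tprod_one_add_of_dominated_convergence
      (bound := fun t : ℕ => 100 * (|ε| + 2) ^ 2 / ((t : ℝ) + 1) ^ 2) ?_ (fun t => ?_) ?_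
    · simpa [div_eq_mul_inv] using summable_inv_sq.mul_left (100 * (|ε| + 2) ^ 2)
    · refine (tendsto_pairDev hℓ hpos hper k ε t).congr' ?_
      filter_upwards [tendsto_fst.eventually (htop.eventually_gt_atTop t)] with z hz
      rw [if_pos hz]
    · have hε : ∀ᶠ x in 𝓝 ε, |x| < |ε| + 1 :=
        continuous_abs.continuousAt.eventually_lt_const (lt_add_one _)
      filter_upwards [tendsto_snd.eventually hε] with z hz t
      split_ifs with ht
      · exact abs_pairDev_le hpos (by linarith) (le_trans ht (hle z.1))
      · rw [norm_zero]; positivity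
  have h2 := key.abs
  rw [← limProd_eq_abs hℓ hpos hper] at h2
  refine h2.congr fun z => ?_
  rw [← Finset.abs_prod, tprod_eq_prod (s := Finset.range (h z.1))]
  · congr 1
    exact Finset.prod_congr rfl fun t ht => by rw [if_pos (Finset.mem_range.1 ht)]
  · intro t ht
    rw [if_neg (by simpa using ht), add_zero]

/-- The main part of the squared product, independent of the perturbation. -/
noncomputable def mainPart (d : ℤ → ℕ) (n : ℕ) : ℝ :=
  (∏ t ∈ Finset.range (q d (n + 1) / 2),
      (2 * Real.sin (Real.pi * centre d n (t + 1) / q d (n + 1))) ^ 2) *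
    ∏ t ∈ Finset.range (q d (n + 1) - 1 - q d (n + 1) / 2),
      (2 * Real.sin (Real.pi * centre d n (t + 1) / q d (n + 1))) ^ 2

/-- The paired part of the squared product, relative to its main part. -/
noncomputable def devPart (d : ℤ → ℕ) (n : ℕ) (ε : ℝ) : ℝ :=
  (∏ t ∈ Finset.range (q d (n + 1) / 2), |1 + pairDev d n ε t|) *
    ∏ t ∈ Finset.range (q d (n + 1) - 1 - q d (n + 1) / 2), |1 + pairDev d n ε t|

lemma mainPart_pos {d : ℤ → ℕ} (hpos : ∀ i, 1 ≤ d i) (n : ℕ) : 0 < mainPart d n := by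
  refine mul_pos (Finset.prod_pos fun t ht => ?_) (Finset.prod_pos fun t ht => ?_) <;>
  · rw [Finset.mem_range] at ht
    have := sin_centre_pos hpos (n := n) (t := t) (by omega)
    positivity

lemma perturbedSudler_sq_eq {d : ℤ → ℕ} (hpos : ∀ i, 1 ≤ d i) (n : ℕ) (ε : ℝ) :
    perturbedSudler d (n + 1) ε ^ 2 =
      (2 * Real.sin (Real.pi * (ε + scaledErr d (n + 1)) / q d (n + 1))) ^ 2 *
        (mainPart d n * devPart d n ε) := by
  rw [perturbedSudler_sq hpos, mainPart, devPart, mul_mul_mul_comm, ← Finset.prod_mul_distrib,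
    ← Finset.prod_mul_distrib]
  congr 2 <;> refine Finset.prod_congr rfl fun t ht => ?_ <;>
  · rw [Finset.mem_range] at ht
    exact pairFactor_eq_mul hpos ε (by omega)

lemma tendsto_devPart {d : ℤ → ℕ} {ℓ : ℕ} (hℓ : 1 ≤ ℓ) (hpos : ∀ i, 1 ≤ d i)
    (hper : ∀ i, d (i + ℓ) = d i) (k : ℕ) (ε : ℝ) :
    Tendsto (fun z : ℕ × ℝ => devPart d (z.1 * ℓ + k) z.2) (atTop ×ˢ 𝓝 ε)
      (𝓝 (limProd d ℓ (k + 1) (1 + 2 * ε / errLim d ℓ (k + 1)) ^ 2)) := by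
  have hq := q_tendsto_atTop hℓ hpos (k + 1)
  rw [sq]
  refine (tendsto_prod_pairDev hℓ hpos hper k ε
    (h := fun m => q d (m * ℓ + k + 1) / 2) ?_ fun m => le_rfl).mul
    (tendsto_prod_pairDev hℓ hpos hper k ε
      (h := fun m => q d (m * ℓ + k + 1) - 1 - q d (m * ℓ + k + 1) / 2) ?_ fun m => by omega)
  · refine tendsto_atTop_atTop.2 fun b => ?_
    obtain ⟨i, hi⟩ := tendsto_atTop_atTop.1 hq (2 * b)
    exact ⟨i, fun m hm => by have : 2 * b ≤ q d (m * ℓ + k + 1) := hi m hm; omega⟩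
  · refine tendsto_atTop_atTop.2 fun b => ?_
    obtain ⟨i, hi⟩ := tendsto_atTop_atTop.1 hq (2 * b + 2)
    exact ⟨i, fun m hm => by have : 2 * b + 2 ≤ q d (m * ℓ + k + 1) := hi m hm; omega⟩

lemma perturbedSudler_nonneg (d : ℤ → ℕ) (n : ℕ) (ε : ℝ) : 0 ≤ perturbedSudler d n ε :=
  Finset.prod_nonneg fun _ _ => by positivity

/-- The limit of `P_{q_n}(α, ε) / P_{q_n}(α, 0)` along `n ≡ k` modulo the period. -/
noncomputable def relLim (d : ℤ → ℕ) (ℓ k : ℕ) (ε : ℝ) : ℝ :=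
  |1 + ε / errLim d ℓ k| * (limProd d ℓ k (1 + 2 * ε / errLim d ℓ k) / limProd d ℓ k 1)

lemma tendsto_relLim {d : ℤ → ℕ} {ℓ : ℕ} (hℓ : 1 ≤ ℓ) (hpos : ∀ i, 1 ≤ d i)
    (hper : ∀ i, d (i + ℓ) = d i) (k : ℕ) (ε : ℝ) :
    Tendsto (fun z : ℕ × ℝ => perturbedSudler d (z.1 * ℓ + k + 1) z.2 /
      perturbedSudler d (z.1 * ℓ + k + 1) 0) (atTop ×ˢ 𝓝 ε) (𝓝 (relLim d ℓ (k + 1) ε)) := by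
  have hN : Tendsto (fun z : ℕ × ℝ => q d (z.1 * ℓ + k + 1)) (atTop ×ˢ 𝓝 ε) atTop :=
    (q_tendsto_atTop hℓ hpos (k + 1)).comp tendsto_fst
  have hs := (tendsto_scaledErr hℓ hpos hper (k + 1)).comp (tendsto_fst (f := atTop) (g := 𝓝 ε))
  have h1 := tendsto_mul_sin (tendsto_snd.add hs) hN
  have h2 := tendsto_mul_sin hs hN
  have hfst : Tendsto (fun z : ℕ × ℝ => (z.1, (0 : ℝ))) (atTop ×ˢ 𝓝 ε) (atTop ×ˢ 𝓝 0) :=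
    tendsto_fst.prodMk tendsto_const_nhds
  have h3 := tendsto_devPart hℓ hpos hper k ε
  have h4 := (tendsto_devPart hℓ hpos hper k 0).comp hfst
  have hΛ := errLim_pos hℓ hpos hper (k + 1)
  have hL := limProd_one_pos hℓ hpos hper (k + 1)
  have hpi := Real.pi_pos
  simp only [mul_zero, zero_div, add_zero] at h4
  have h5 := (((h1.div h2 (by positivity)).pow 2).mul (h3.div h4 (by positivity))).sqrt
  have e : √((Real.pi * (ε + errLim d ℓ (k + 1)) / (Real.pi * errLim d ℓ (k + 1))) ^ 2 *
      (limProd d ℓ (k + 1) (1 + 2 * ε / errLim d ℓ (k + 1)) ^ 2 / limProd d ℓ (k + 1) 1 ^ 2)) =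
      relLim d ℓ (k + 1) ε := by
    rw [← div_pow, ← mul_pow, Real.sqrt_sq_eq_abs, abs_mul, relLim]
    congr 1
    · congr 1
      field_simp
      ring
    · refine abs_of_nonneg (div_nonneg ?_ hL.le)
      rw [limProd_eq_abs hℓ hpos hper]
      exact abs_nonneg _
  rw [e] at h5
  refine h5.congr fun z => ?_
  have hq : (0 : ℝ) < q d (z.1 * ℓ + k + 1) := by exact_mod_cast q_succ_pos hpos _
  have hm := mainPart_pos hpos (z.1 * ℓ + k)
  rw [← Real.sqrt_sq (div_nonneg (perturbedSudler_nonneg d (z.1 * ℓ + k + 1) z.2)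
    (perturbedSudler_nonneg d (z.1 * ℓ + k + 1) 0)), div_pow, perturbedSudler_sq_eq hpos,
    perturbedSudler_sq_eq hpos, zero_add]
  congr 1
  simp only [Pi.div_apply, Function.comp]
  rw [mul_div_mul_left _ _ hq.ne', mul_div_mul_comm, mul_div_mul_left _ _ hm.ne', ← div_pow,
    mul_div_mul_left _ _ two_ne_zero]
  rfl

/-! ### Subexponential growth -/

lemma norm_one_sub_exp (x : ℝ) :
    ‖1 - Complex.exp (2 * x * Complex.I)‖ = 2 * |Real.sin x| := by
  have h := Complex.norm_exp_I_mul_ofReal_sub_one (x := 2 * x)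
  rw [norm_sub_rev, mul_div_cancel_left₀ _ two_ne_zero, norm_mul, Real.norm_eq_abs,
    Real.norm_eq_abs, abs_two] at h
  rw [← h]
  congr 3
  push_cast
  ring

/-- The norm of `∏ (1 - ζ ^ j) = N` for a primitive `N`-th root of unity `ζ`. -/
lemma prod_two_mul_sin (N : ℕ) (hN : 1 ≤ N) :
    ∏ j ∈ Finset.Ico 1 N, 2 * |Real.sin (Real.pi * j / N)| = N := by
  obtain ⟨n, rfl⟩ := Nat.exists_eq_add_of_le' hN
  have h := (Complex.isPrimitiveRoot_exp (n + 1) (Nat.succ_ne_zero n)).prod_one_sub_pow_eq_order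
  have h2 := congrArg norm h
  rw [norm_prod] at h2
  rw [Finset.prod_Ico_eq_prod_range, Nat.add_sub_cancel]
  have h3 : ‖(n : ℂ) + 1‖ = ((n + 1 : ℕ) : ℝ) := by
    rw [← Nat.cast_succ, Complex.norm_natCast]
  refine Eq.trans ?_ (h2.trans h3)
  refine Finset.prod_congr rfl fun k _ => ?_
  rw [← norm_one_sub_exp, ← Complex.exp_nat_mul]
  congr 3
  push_cast
  ring

/-- The `(t+1)`-st paired main factor, relative to its value for a rational rotation. -/
noncomputable def centreRatio (d : ℤ → ℕ) (n t : ℕ) : ℝ :=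
  Real.sin (Real.pi * centre d n (t + 1) / q d (n + 1)) /
    Real.sin (Real.pi * (t + 1 : ℕ) / q d (n + 1))

lemma centreRatio_bounds {d : ℤ → ℕ} (hpos : ∀ i, 1 ≤ d i) {n t : ℕ}
    (ht : t + 1 ≤ q d (n + 1) / 2) :
    1 / 10 ≤ centreRatio d n t ∧ |centreRatio d n t - 1| ≤ 1 / ((t : ℝ) + 1) := by
  have hq : (0 : ℝ) < q d (n + 1) := by exact_mod_cast q_succ_pos hpos n
  have hpi := Real.pi_pos
  have h1 := le_abs_sin_centre hpos (Nat.le_add_left 1 t) ht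
  have h3 : ((t + 1 : ℕ) : ℝ) * 2 ≤ q d (n + 1) := by
    exact_mod_cast (Nat.le_div_iff_mul_le two_pos).1 ht
  have hB0 : 0 < Real.pi * (t + 1 : ℕ) / q d (n + 1) := by positivity
  have hB1 : Real.pi * (t + 1 : ℕ) / q d (n + 1) ≤ Real.pi / 2 := by
    rw [div_le_div_iff₀ hq two_pos]; nlinarith
  have hs := Real.mul_le_sin hB0.le hB1
  have hs' : 2 / Real.pi * (Real.pi * (t + 1 : ℕ) / q d (n + 1)) =
      2 * (t + 1 : ℕ) / q d (n + 1) := by field_simp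
  rw [hs'] at hs
  have hs0 : 0 < Real.sin (Real.pi * (t + 1 : ℕ) / q d (n + 1)) :=
    lt_of_lt_of_le (by positivity) hs
  constructor
  · rw [centreRatio, le_div_iff₀ hs0]
    have := Real.sin_le hB0.le
    refine le_trans (mul_le_mul_of_nonneg_left this (by norm_num)) (le_trans (le_of_eq ?_) h1)
    field_simp
  · have hc := abs_centre_sub_le hpos n (t + 1)
    have hd : |Real.sin (Real.pi * centre d n (t + 1) / q d (n + 1)) -
        Real.sin (Real.pi * (t + 1 : ℕ) / q d (n + 1))| ≤ 2 / q d (n + 1) := by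
      refine (Real.abs_sin_sub_sin_le _ _).trans ?_
      rw [← sub_div, ← mul_sub, abs_div, abs_mul, abs_of_pos hpi, abs_of_pos hq]
      have := Real.pi_lt_d2
      gcongr
      nlinarith
    have e : centreRatio d n t - 1 = (Real.sin (Real.pi * centre d n (t + 1) / q d (n + 1)) -
        Real.sin (Real.pi * (t + 1 : ℕ) / q d (n + 1))) /
        Real.sin (Real.pi * (t + 1 : ℕ) / q d (n + 1)) := by
      rw [centreRatio]; field_simp
    rw [e, abs_div, abs_of_pos hs0]
    refine (div_le_div₀ (by positivity) hd (by positivity) hs).trans (le_of_eq ?_)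
    push_cast
    field_simp

/-- The ratios are `1 + O(1 / (t + 1))` with constant at most `1`, so the bounds telescope; the
first ratio is bounded below separately. At `h = 0` the lower bound is `1 / 0 = 0`. -/
lemma prod_centreRatio_bounds {d : ℤ → ℕ} (hpos : ∀ i, 1 ≤ d i) (n : ℕ) {h : ℕ}
    (hh : h ≤ q d (n + 1) / 2) :
    1 / (10 * (h : ℝ)) ≤ ∏ t ∈ Finset.range h, centreRatio d n t ∧
      ∏ t ∈ Finset.range h, centreRatio d n t ≤ h + 1 := by
  induction h with
  | zero => simp
  | succ h ih =>
    obtain ⟨h1, h2⟩ := ih (by omega)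
    obtain ⟨h3, h4⟩ := centreRatio_bounds hpos hh
    obtain ⟨h5, h6⟩ := abs_le.1 h4
    have hn : (0 : ℝ) ≤ h := by positivity
    rw [Finset.prod_range_succ]
    have hP0 : 0 ≤ ∏ t ∈ Finset.range h, centreRatio d n t := le_trans (by positivity) h1
    constructor
    · rcases Nat.eq_zero_or_pos h with rfl | hh0
      · simpa using h3
      · have hn0 : (0 : ℝ) < h := by exact_mod_cast hh0
        have h7 : (h : ℝ) / (h + 1) ≤ centreRatio d n h := by
          have : (h : ℝ) / (h + 1) = 1 - 1 / (h + 1) := by field_simp; ring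
          linarith
        calc 1 / (10 * ((h + 1 : ℕ) : ℝ)) = 1 / (10 * (h : ℝ)) * (h / (h + 1)) := by
              push_cast; field_simp
          _ ≤ _ := mul_le_mul h1 h7 (by positivity) hP0
    · have h7 : centreRatio d n h ≤ (h + 2) / (h + 1) := by
        have : ((h : ℝ) + 2) / (h + 1) = 1 + 1 / (h + 1) := by field_simp; ring
        linarith
      calc _ ≤ ((h : ℝ) + 1) * ((h + 2) / (h + 1)) := mul_le_mul h2 h7 (by linarith) (by positivity)
        _ = _ := by push_cast; field_simp; ring

lemma mainPart_eq {d : ℤ → ℕ} (hpos : ∀ i, 1 ≤ d i) (n : ℕ) :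
    mainPart d n = q d (n + 1) ^ 2 *
      ((∏ t ∈ Finset.range (q d (n + 1) / 2), centreRatio d n t) ^ 2 *
        (∏ t ∈ Finset.range (q d (n + 1) - 1 - q d (n + 1) / 2), centreRatio d n t) ^ 2) := by
  have hq1 := q_succ_pos hpos n
  have hq : (0 : ℝ) < q d (n + 1) := by exact_mod_cast hq1
  have hpi := Real.pi_pos
  have hsplit := prod_Ico_symm (q d (n + 1)) hq1
    (fun j : ℕ => (2 * |Real.sin (Real.pi * j / q d (n + 1))|) ^ 2) (fun j hj => by
      have e : Real.pi * (q d (n + 1) - j : ℕ) / q d (n + 1) =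
          Real.pi - Real.pi * j / q d (n + 1) := by
        rw [Nat.cast_sub (Finset.mem_Ico.1 hj).2.le]; field_simp
      simp only [e, Real.sin_pi_sub])
  rw [Finset.prod_pow, prod_two_mul_sin _ hq1] at hsplit
  rw [hsplit, mul_mul_mul_comm, mainPart, ← Finset.prod_pow, ← Finset.prod_pow,
    ← Finset.prod_mul_distrib, ← Finset.prod_mul_distrib]
  congr 1 <;> refine Finset.prod_congr rfl fun t ht => ?_ <;>
  · rw [Finset.mem_range] at ht
    have ht' : t + 1 ≤ q d (n + 1) / 2 := by omega
    have h3 : (t + 1) * 2 ≤ q d (n + 1) := (Nat.le_div_iff_mul_le two_pos).1 ht'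
    have h4 : ((t + 1 : ℕ) : ℝ) < q d (n + 1) := by exact_mod_cast (by omega)
    have hs0 : 0 < Real.sin (Real.pi * (t + 1 : ℕ) / q d (n + 1)) := by
      refine Real.sin_pos_of_pos_of_lt_pi (by positivity) ?_
      rw [div_lt_iff₀ hq]
      exact mul_lt_mul_of_pos_left h4 hpi
    rw [abs_of_pos hs0, centreRatio]
    field_simp

lemma abs_log_le_of_le_of_le {x y : ℝ} (hy : 0 < y) (h1 : 1 / y ≤ x) (h2 : x ≤ y) :
    |Real.log x| ≤ Real.log y := by
  have hx : 0 < x := lt_of_lt_of_le (by positivity) h1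
  refine abs_le.2 ⟨?_, Real.log_le_log hx h2⟩
  rw [← Real.log_inv, ← one_div]
  exact Real.log_le_log (by positivity) h1

lemma abs_log_mainPart_le {d : ℤ → ℕ} (hpos : ∀ i, 1 ≤ d i) {n : ℕ} (hn : 3 ≤ q d (n + 1)) :
    |Real.log (mainPart d n / q d (n + 1) ^ 2)| ≤ 4 * Real.log (10 * q d (n + 1)) := by
  have hq : (0 : ℝ) < q d (n + 1) := by exact_mod_cast q_succ_pos hpos n
  have key {h : ℕ} (h1 : 1 ≤ h) (hh : h ≤ q d (n + 1) / 2) :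
      0 < ∏ t ∈ Finset.range h, centreRatio d n t ∧
      |Real.log (∏ t ∈ Finset.range h, centreRatio d n t)| ≤ Real.log (10 * q d (n + 1)) := by
    obtain ⟨h2, h3⟩ := prod_centreRatio_bounds hpos n hh
    have h4 : (1 : ℝ) ≤ h := by exact_mod_cast h1
    have h5 : (h : ℝ) ≤ q d (n + 1) := by exact_mod_cast hh.trans (Nat.div_le_self _ _)
    refine ⟨lt_of_lt_of_le (by positivity) h2, abs_log_le_of_le_of_le (by positivity)
      (le_trans ?_ h2) (by linarith)⟩
    exact one_div_le_one_div_of_le (by positivity) (by linarith)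
  obtain ⟨a1, a2⟩ := key (h := q d (n + 1) / 2) (by omega) le_rfl
  obtain ⟨b1, b2⟩ := key (h := q d (n + 1) - 1 - q d (n + 1) / 2) (by omega) (by omega)
  rw [mainPart_eq hpos, mul_div_cancel_left₀ _ (by positivity),
    Real.log_mul (by positivity) (by positivity), Real.log_pow, Real.log_pow]
  refine (abs_add_le _ _).trans ?_
  rw [abs_mul, abs_mul]
  norm_num
  linarith

lemma perturbedSudler_zero_eq (d : ℤ → ℕ) (n : ℕ) :
    perturbedSudler d n 0 = sudler (cfValue d) (q d n) := by
  rw [perturbedSudler, sudler]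
  exact Finset.prod_congr rfl fun r _ => by simp [abs_mul]

lemma sin_pi_mul_ne_zero {α : ℝ} (hα : Irrational α) {r : ℕ} (hr : r ≠ 0) :
    Real.sin (Real.pi * (r * α)) ≠ 0 := by
  rw [Real.sin_ne_zero_iff]
  intro n hn
  rw [mul_comm (n : ℝ)] at hn
  exact (hα.natCast_mul hr).ne_int n (mul_left_cancel₀ Real.pi_ne_zero hn).symm

lemma sudler_pos {α : ℝ} (hα : Irrational α) (N : ℕ) : 0 < sudler α N :=
  Finset.prod_pos fun r hr => abs_pos.2 (mul_ne_zero two_ne_zero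
    (sin_pi_mul_ne_zero hα (by rw [Finset.mem_Icc] at hr; omega)))

lemma tendsto_log_q_div {d : ℤ → ℕ} {ℓ : ℕ} (hℓ : 1 ≤ ℓ) (hpos : ∀ i, 1 ≤ d i)
    (hper : ∀ i, d (i + ℓ) = d i) (k : ℕ) :
    Tendsto (fun m : ℕ => 4 * Real.log (10 * q d (m * ℓ + k + 1)) / a d ℓ ^ m) atTop (𝓝 0) := by
  have ha := (one_lt_a_and_a_mul_b hℓ hpos).1
  have ha0 : 0 < a d ℓ := by linarith
  have he := abs_err_pos hpos (k + 1)
  have hbound (m : ℕ) : Real.log (10 * q d (m * ℓ + k + 1)) ≤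
      Real.log (10 / |err d (k + 1)|) + m * Real.log (a d ℓ) := by
    have hq : (0 : ℝ) < q d (m * ℓ + k + 1) := by exact_mod_cast q_succ_pos hpos _
    rw [← Real.log_pow, ← Real.log_mul (by positivity) (by positivity)]
    refine Real.log_le_log (by positivity) ?_
    have h1 : (q d (m * ℓ + k + 1) : ℝ) * |err d (m * ℓ + k + 1)| ≤ 1 :=
      scaledErr_le_one hpos (m * ℓ + k + 1)
    have h2 : |err d (m * ℓ + k + 1)| * a d ℓ ^ m = |err d (k + 1)| :=
      abs_err_mul_a_pow hℓ hpos hper m (k + 1)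
    rw [div_mul_eq_mul_div, le_div_iff₀ he, ← h2]
    have := mul_le_mul_of_nonneg_right h1 (show 0 ≤ 10 * a d ℓ ^ m by positivity)
    linarith
  have h1 : Tendsto (fun m : ℕ => 4 * (Real.log (10 / |err d (k + 1)|) * (1 / a d ℓ ^ m)
      + (m : ℝ) ^ 1 / a d ℓ ^ m * Real.log (a d ℓ))) atTop (𝓝 0) := by
    have h2 := tendsto_pow_const_div_const_pow_of_one_lt 1 ha
    have h3 := tendsto_pow_const_div_const_pow_of_one_lt 0 ha
    simp only [pow_zero] at h3
    simpa using ((h3.const_mul (Real.log (10 / |err d (k + 1)|))).add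
      (h2.mul_const (Real.log (a d ℓ)))).const_mul 4
  refine squeeze_zero (fun m => ?_) (fun m => ?_) h1
  · have hq : (1 : ℝ) ≤ q d (m * ℓ + k + 1) := by exact_mod_cast q_succ_pos hpos _
    have := Real.log_nonneg (show 1 ≤ 10 * (q d (m * ℓ + k + 1) : ℝ) by linarith)
    positivity
  · have h4 := hbound m
    have e : 4 * (Real.log (10 / |err d (k + 1)|) * (1 / a d ℓ ^ m)
      + (m : ℝ) ^ 1 / a d ℓ ^ m * Real.log (a d ℓ)) =
      4 * (Real.log (10 / |err d (k + 1)|) + m * Real.log (a d ℓ)) / a d ℓ ^ m := by ring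
    rw [e]
    gcongr

/-- The Sudler products at the denominators grow subexponentially in the denominators. -/
lemma tendsto_log_sudler_div {d : ℤ → ℕ} {ℓ : ℕ} (hℓ : 1 ≤ ℓ) (hpos : ∀ i, 1 ≤ d i)
    (hper : ∀ i, d (i + ℓ) = d i) (k : ℕ) :
    Tendsto (fun m : ℕ => Real.log (perturbedSudler d (m * ℓ + k + 1) 0) / a d ℓ ^ m) atTop
      (𝓝 0) := by
  have ha := (one_lt_a_and_a_mul_b hℓ hpos).1
  have ha0 : 0 < a d ℓ := by linarith
  have hq := q_tendsto_atTop hℓ hpos (k + 1)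
  have hpi := Real.pi_pos
  have hΛ := errLim_pos hℓ hpos hper (k + 1)
  have hL := limProd_one_pos hℓ hpos hper (k + 1)
  have hinv : Tendsto (fun m : ℕ => (a d ℓ ^ m)⁻¹) atTop (𝓝 0) :=
    (tendsto_pow_atTop_atTop_of_one_lt ha).inv_tendsto_atTop
  have h1 : Tendsto (fun m : ℕ => (q d (m * ℓ + k + 1) : ℝ) *
      Real.sin (Real.pi * scaledErr d (m * ℓ + k + 1) / q d (m * ℓ + k + 1))) atTop
      (𝓝 (Real.pi * errLim d ℓ (k + 1))) :=
    tendsto_mul_sin (tendsto_scaledErr hℓ hpos hper (k + 1)) hq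
  have h2 := (tendsto_devPart hℓ hpos hper k 0).comp
    (tendsto_id.prodMk (tendsto_const_nhds (x := (0 : ℝ)) (f := (atTop : Filter ℕ))))
  simp only [mul_zero, zero_div, add_zero] at h2
  have h3 := ((h1.const_mul 2).pow 2).mul h2
  have hlim : (2 * (Real.pi * errLim d ℓ (k + 1))) ^ 2 * limProd d ℓ (k + 1) 1 ^ 2 ≠ 0 := by
    positivity
  have h4 := (h3.log hlim).mul hinv
  rw [mul_zero] at h4
  have h5 : Tendsto (fun m : ℕ => Real.log (mainPart d (m * ℓ + k) / q d (m * ℓ + k + 1) ^ 2)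
      * (a d ℓ ^ m)⁻¹) atTop (𝓝 0) := by
    refine squeeze_zero_norm' ?_ (tendsto_log_q_div hℓ hpos hper k)
    filter_upwards [hq.eventually_ge_atTop 3] with m hm
    rw [norm_mul, Real.norm_eq_abs, Real.norm_of_nonneg (by positivity), div_eq_mul_inv]
    exact mul_le_mul_of_nonneg_right (abs_log_mainPart_le hpos hm) (by positivity)
  have h6 := (h4.add h5).const_mul (1 / 2)
  rw [add_zero, mul_zero] at h6
  refine h6.congr' ?_
  filter_upwards [h3.eventually_ne hlim] with m hm
  have hq0 : (0 : ℝ) < q d (m * ℓ + k + 1) := by exact_mod_cast q_succ_pos hpos _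
  have hmp := mainPart_pos hpos (m * ℓ + k)
  have hsq := perturbedSudler_sq_eq hpos (m * ℓ + k) 0
  rw [zero_add] at hsq
  simp only [Function.comp, id] at hm ⊢
  have e : perturbedSudler d (m * ℓ + k + 1) 0 ^ 2 =
      ((2 * ((q d (m * ℓ + k + 1) : ℝ) * Real.sin (Real.pi * scaledErr d (m * ℓ + k + 1) /
        q d (m * ℓ + k + 1)))) ^ 2 * devPart d (m * ℓ + k) 0) *
        (mainPart d (m * ℓ + k) / q d (m * ℓ + k + 1) ^ 2) := by
    rw [hsq]; field_simp
  have e2 : 2 * Real.log (perturbedSudler d (m * ℓ + k + 1) 0) =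
      Real.log (perturbedSudler d (m * ℓ + k + 1) 0 ^ 2) := by
    rw [Real.log_pow]; norm_num
  rw [e, Real.log_mul hm (by positivity)] at e2
  rw [div_eq_mul_inv, ← add_mul, ← e2]
  ring

/-! ### Multiplicative structure of Sudler products -/

/-- The product of `|2 sin π (r α + x)|` over `1 ≤ r ≤ N`. -/
noncomputable def shifted (α : ℝ) (N : ℕ) (x : ℝ) : ℝ :=
  ∏ r ∈ Finset.range N, |2 * Real.sin (Real.pi * ((r + 1 : ℕ) * α + x))|

lemma shifted_add (α : ℝ) (M N : ℕ) (x : ℝ) :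
    shifted α (M + N) x = shifted α M x * shifted α N (x + M * α) := by
  rw [shifted, Finset.prod_range_add]
  congr 1
  refine Finset.prod_congr rfl fun r _ => ?_
  congr 4
  push_cast
  ring

lemma shifted_mul (α : ℝ) (M N : ℕ) (x : ℝ) :
    shifted α (M * N) x = ∏ s ∈ Finset.range M, shifted α N (x + s * N * α) := by
  induction M with
  | zero => simp [shifted]
  | succ M ih =>
    rw [add_mul, one_mul, shifted_add, ih, Finset.prod_range_succ]
    push_cast
    rfl

lemma shifted_add_int (α : ℝ) (N : ℕ) (x : ℝ) (z : ℤ) :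
    shifted α N (x + z) = shifted α N x := by
  refine Finset.prod_congr rfl fun r _ => ?_
  rw [abs_mul, abs_mul, ← add_assoc, mul_add, mul_comm Real.pi (z : ℝ), abs_sin_add_int_mul_pi]

lemma shifted_pos {α : ℝ} (hα : Irrational α) (N M : ℕ) : 0 < shifted α N (M * α) := by
  refine Finset.prod_pos fun r _ => abs_pos.2 (mul_ne_zero two_ne_zero ?_)
  rw [← add_mul, ← Nat.cast_add]
  exact sin_pi_mul_ne_zero hα (by omega)

lemma perturbedSudler_eq_shifted (d : ℤ → ℕ) (n : ℕ) (ε : ℝ) :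
    perturbedSudler d n ε = shifted (cfValue d) (q d n) ((-1) ^ (n + 1) * (ε / q d n)) := by
  rw [perturbedSudler, shifted, Finset.range_eq_Ico,
    Finset.prod_Ico_add' (fun r : ℕ => |2 * Real.sin (Real.pi * (r * cfValue d +
      (-1) ^ (n + 1) * (ε / q d n)))|) 0 (q d n) 1, zero_add]
  refine Finset.prod_congr rfl fun r _ => by rw [abs_mul, abs_two]

/-- A block of length `q_n` starting at a multiple of `α` which is `x (q_n α - p_n)` modulo `1`. -/
lemma shifted_eq_perturbedSudler {d : ℤ → ℕ} (hpos : ∀ i, 1 ≤ d i) (n : ℕ) {x y : ℝ} {z : ℤ}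
    (hy : y = x * err d (n + 1) + z) :
    shifted (cfValue d) (q d (n + 1)) y = perturbedSudler d (n + 1) (x * scaledErr d (n + 1)) := by
  have hq : (0 : ℝ) < q d (n + 1) := by exact_mod_cast q_succ_pos hpos n
  rw [perturbedSudler_eq_shifted, hy, shifted_add_int,
    (err_eq_sign_mul_and_ne_zero hpos (n + 1)).1, scaledErr]
  congr 1
  field_simp

lemma q_mul_eq (d : ℤ → ℕ) (n : ℕ) :
    (q d n * cfValue d) = err d n + ((p d n : ℤ) : ℝ) := by
  rw [err]; push_cast; ring

lemma err_eq_of_odd {d : ℤ → ℕ} {ℓ : ℕ} (hℓ : 1 ≤ ℓ) (hpos : ∀ i, 1 ≤ d i)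
    (hper : ∀ i, d (i + ℓ) = d i) (ho : Odd ℓ) (n : ℕ) :
    err d n = -(a d ℓ) * err d (n + ℓ) := by
  have h := (one_lt_a_and_a_mul_b hℓ hpos).2
  rw [ho.neg_one_pow] at h
  rw [err_add_period hℓ hpos hper]
  linear_combination err d n * h

lemma err_eq_of_even {d : ℤ → ℕ} {ℓ : ℕ} (hℓ : 1 ≤ ℓ) (hpos : ∀ i, 1 ≤ d i)
    (hper : ∀ i, d (i + ℓ) = d i) (he : Even ℓ) (n : ℕ) :
    err d n = a d ℓ ^ 2 * err d (n + 2 * ℓ) := by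
  have h := (one_lt_a_and_a_mul_b hℓ hpos).2
  rw [he.neg_one_pow] at h
  rw [two_mul, ← add_assoc, err_add_period hℓ hpos hper, err_add_period hℓ hpos hper]
  linear_combination (-err d n) * (a d ℓ * b d ℓ + 1) * h

/-- Start of the blocks in the splitting of `sudler_odd_eq`. -/
lemma odd_block_start {d : ℤ → ℕ} {ℓ : ℕ} (hℓ : 1 ≤ ℓ) (hpos : ∀ i, 1 ≤ d i)
    (hper : ∀ i, d (i + ℓ) = d i) (ho : Odd ℓ) (n s : ℕ) :
    ((q d n + s * q d (n + ℓ) : ℕ) : ℝ) * cfValue d =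
      (s - a d ℓ) * err d (n + ℓ) + ((p d n + s * p d (n + ℓ) : ℤ) : ℝ) := by
  have h1 := err_eq_of_odd hℓ hpos hper ho n
  have h2 := q_mul_eq d n
  have h3 := q_mul_eq d (n + ℓ)
  push_cast at h2 h3 ⊢
  linear_combination h2 + h1 + (s : ℝ) * h3

lemma even_block_start (d : ℤ → ℕ) (n s : ℕ) :
    ((s * q d n : ℕ) : ℝ) * cfValue d = s * err d n + ((s * p d n : ℤ) : ℝ) := by
  have h3 := q_mul_eq d n
  push_cast at h3 ⊢
  linear_combination (s : ℝ) * h3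

/-- Start of the long block in the splitting of `sudler_even_eq`. -/
lemma even_long_block_start {d : ℤ → ℕ} {ℓ : ℕ} (hℓ : 1 ≤ ℓ) (hpos : ∀ i, 1 ≤ d i)
    (hper : ∀ i, d (i + ℓ) = d i) (he : Even ℓ) (n : ℕ) :
    (q d n : ℝ) * cfValue d = a d ℓ ^ 2 * err d (n + 2 * ℓ) + ((p d n : ℤ) : ℝ) := by
  rw [q_mul_eq, err_eq_of_even hℓ hpos hper he n]

/-- For an odd period `q_{n+2ℓ} = q_n + c q_{n+ℓ}`, and the product splits accordingly. -/
lemma sudler_odd_eq {d : ℤ → ℕ} {ℓ : ℕ} (hℓ : 1 ≤ ℓ) (hpos : ∀ i, 1 ≤ d i)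
    (hper : ∀ i, d (i + ℓ) = d i) (ho : Odd ℓ) (n : ℕ) :
    perturbedSudler d (n + 1 + 2 * ℓ) 0 = perturbedSudler d (n + 1) 0 *
      ∏ s ∈ Finset.range (c d ℓ), perturbedSudler d (n + 1 + ℓ)
        ((s - a d ℓ) * scaledErr d (n + 1 + ℓ)) := by
  have hq : q d (n + 1 + 2 * ℓ) = q d (n + 1) + c d ℓ * q d (n + 1 + ℓ) := by
    have h := q_add_two_period hper (n + 1)
    rw [ho.neg_one_pow, neg_one_mul, sub_neg_eq_add, add_comm (_ * _)] at h
    exact_mod_cast h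
  rw [perturbedSudler_eq_shifted, perturbedSudler_eq_shifted, zero_div, zero_div, mul_zero,
    mul_zero, hq, shifted_add, shifted_mul]
  congr 1
  refine Finset.prod_congr rfl fun s _ => ?_
  have h := odd_block_start hℓ hpos hper ho (n + 1) s
  rw [show n + 1 + ℓ = (n + ℓ) + 1 by ring] at h ⊢
  refine shifted_eq_perturbedSudler hpos (n + ℓ) (h.symm.trans ?_).symm
  push_cast
  ring

/-- For an even period `q_n + q_{n+2ℓ} = c q_{n+ℓ}`, and both sides give a splitting. -/
lemma sudler_even_eq {d : ℤ → ℕ} {ℓ : ℕ} (hℓ : 1 ≤ ℓ) (hpos : ∀ i, 1 ≤ d i)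
    (hper : ∀ i, d (i + ℓ) = d i) (he : Even ℓ) (n : ℕ) :
    perturbedSudler d (n + 1) 0 *
      perturbedSudler d (n + 1 + 2 * ℓ) (a d ℓ ^ 2 * scaledErr d (n + 1 + 2 * ℓ)) =
      ∏ s ∈ Finset.range (c d ℓ), perturbedSudler d (n + 1 + ℓ)
        (s * scaledErr d (n + 1 + ℓ)) := by
  have hq : q d (n + 1) + q d (n + 1 + 2 * ℓ) = c d ℓ * q d (n + 1 + ℓ) := by
    have h := q_add_two_period hper (n + 1)
    rw [he.neg_one_pow, one_mul, eq_sub_iff_add_eq, add_comm] at h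
    exact_mod_cast h
  have h1 : shifted (cfValue d) (q d (n + 1 + 2 * ℓ)) (q d (n + 1) * cfValue d) =
      perturbedSudler d (n + 1 + 2 * ℓ) (a d ℓ ^ 2 * scaledErr d (n + 1 + 2 * ℓ)) := by
    rw [show n + 1 + 2 * ℓ = (n + 2 * ℓ) + 1 by ring]
    have h2 := even_long_block_start hℓ hpos hper he (n + 1)
    rw [show n + 1 + 2 * ℓ = (n + 2 * ℓ) + 1 by ring] at h2
    exact shifted_eq_perturbedSudler hpos (n + 2 * ℓ) h2
  rw [← h1, perturbedSudler_eq_shifted, zero_div, mul_zero,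
    ← zero_add ((q d (n + 1) : ℝ) * cfValue d), ← shifted_add, hq, shifted_mul]
  refine Finset.prod_congr rfl fun s _ => ?_
  rw [show n + 1 + ℓ = (n + ℓ) + 1 by ring]
  refine shifted_eq_perturbedSudler hpos (n + ℓ)
    ((even_block_start d (n + ℓ + 1) s).symm.trans ?_).symm
  push_cast
  ring

/-! ### Badly approximable numbers and nonvanishing of the limits -/

lemma cfValue_quadratic {d : ℤ → ℕ} {ℓ : ℕ} (hℓ : 1 ≤ ℓ) (hpos : ∀ i, 1 ≤ d i)
    (hper : ∀ i, d (i + ℓ) = d i) :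
    q d ℓ * cfValue d ^ 2 + (q d (ℓ + 1) - p d ℓ) * cfValue d - p d (ℓ + 1) = 0 := by
  have h0 := err_add_period hℓ hpos hper 0
  have h1 := err_add_period hℓ hpos hper 1
  rw [zero_add, err_zero, err] at h0
  rw [add_comm 1 ℓ, err_one, err] at h1
  linear_combination cfValue d * h0 + h1

open Polynomial in
/-- Quadratic irrationals are badly approximable. -/
lemma exists_le_abs_sin {d : ℤ → ℕ} {ℓ : ℕ} (hℓ : 1 ≤ ℓ) (hpos : ∀ i, 1 ≤ d i)
    (hper : ∀ i, d (i + ℓ) = d i) :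
    ∃ κ : ℝ, 0 < κ ∧ ∀ r : ℕ, 1 ≤ r → κ / r ≤ |Real.sin (Real.pi * (r * cfValue d))| := by
  have hquad := cfValue_quadratic hℓ hpos hper
  set f : ℤ[X] := C (q d ℓ : ℤ) * X ^ 2 + C ((q d (ℓ + 1) : ℤ) - p d ℓ) * X + C (-(p d (ℓ + 1) : ℤ))
    with hf
  have hq0 : (q d ℓ : ℤ) ≠ 0 := by exact_mod_cast (q_pos hpos hℓ).ne'
  have hdeg : f.natDegree = 2 := natDegree_quadratic hq0
  have hf0 : f ≠ 0 := fun h => by rw [h] at hdeg; simp at hdeg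
  have hroot : eval (cfValue d) (map (algebraMap ℤ ℝ) f) = 0 := by
    rw [hf]
    simp
    linarith
  obtain ⟨A, hA, h⟩ := Liouville.exists_pos_real_of_irrational_root (cfValue_irrational hpos) hf0
    hroot
  refine ⟨2 / A, by positivity, fun r hr => ?_⟩
  obtain ⟨n, rfl⟩ := Nat.exists_eq_add_of_le' hr
  have hr0 : (0 : ℝ) < (n : ℝ) + 1 := by positivity
  have h1 := h (round (((n + 1 : ℕ) : ℝ) * cfValue d)) n
  set z := round (((n + 1 : ℕ) : ℝ) * cfValue d) with hz
  have h2 : |((n + 1 : ℕ) : ℝ) * cfValue d - z| ≤ 1 / 2 := abs_sub_round _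
  have h3 : |Real.sin (Real.pi * ((n + 1 : ℕ) * cfValue d))| =
      |Real.sin (Real.pi * (((n + 1 : ℕ) : ℝ) * cfValue d - z))| := by
    rw [← abs_sin_add_int_mul_pi (Real.pi * (((n + 1 : ℕ) : ℝ) * cfValue d - z)) z]
    congr 2
    ring
  have hpi := Real.pi_pos
  have h4 : 2 / Real.pi * |Real.pi * (((n + 1 : ℕ) : ℝ) * cfValue d - z)| ≤
      |Real.sin (Real.pi * (((n + 1 : ℕ) : ℝ) * cfValue d - z))| := by
    refine Real.mul_abs_le_abs_sin ?_
    rw [abs_mul, abs_of_pos hpi]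
    nlinarith
  rw [h3]
  refine le_trans ?_ h4
  rw [abs_mul, abs_of_pos hpi]
  have h5 : |((n + 1 : ℕ) : ℝ) * cfValue d - z| = ((n : ℝ) + 1) * |cfValue d - z / (n + 1)| := by
    rw [← abs_of_pos hr0, ← abs_mul, abs_of_pos hr0]
    congr 1
    push_cast
    field_simp
  rw [hdeg] at h1
  have h6 : 1 ≤ A * (((n : ℝ) + 1) * |((n + 1 : ℕ) : ℝ) * cfValue d - z|) := by
    rw [h5]; linarith
  rw [← mul_assoc, div_mul_cancel₀ _ hpi.ne', div_div, div_le_iff₀ (by positivity)]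
  push_cast at h6 ⊢
  nlinarith

/-- If the perturbation `x λ` is realized by blocks of the orbit that start at a bounded multiple of
`q_n`, then no factor of the limit vanishes at `x λ`: the points of such a block stay at distance
at least a constant times `1 / q_n` from the integers. -/
lemma one_sub_div_u_sq_ne_zero {d : ℤ → ℕ} {ℓ : ℕ} (hℓ : 1 ≤ ℓ) (hpos : ∀ i, 1 ≤ d i)
    (hper : ∀ i, d (i + ℓ) = d i) (k : ℕ) {x : ℝ} (K : ℕ) (M : ℕ → ℕ) (z : ℕ → ℤ)
    (hM : ∀ᶠ m : ℕ in atTop, M m * cfValue d = x * err d (m * ℓ + k + 1) + z m)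
    (hK : ∀ᶠ m : ℕ in atTop, M m ≤ K * q d (m * ℓ + k + 1)) (t : ℕ) :
    1 - (1 + 2 * x) ^ 2 / u d ℓ (k + 1) (t + 1) ^ 2 ≠ 0 := by
  obtain ⟨κ, hκ, hsin⟩ := exists_le_abs_sin hℓ hpos hper
  have hpi := Real.pi_pos
  have hΛ := errLim_pos hℓ hpos hper (k + 1)
  have hu : 0 < u d ℓ (k + 1) (t + 1) :=
    lt_of_lt_of_le (by positivity) (add_one_le_u hℓ hpos hper (k + 1) t)
  have hq := q_tendsto_atTop hℓ hpos (k + 1)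
  have hs := tendsto_scaledErr hℓ hpos hper (k + 1)
  have h1 := tendsto_mul_sin (tendsto_centre hℓ hpos hper k t) hq
  have h2 := tendsto_mul_sin ((hs.const_mul x).add (hs.div_const 2)) hq
  have h3 := (((h1.pow 2).sub (h2.pow 2)).abs).const_mul 4
  have hge : (2 * κ / (K + 1)) ^ 2 ≤ 4 * |(Real.pi * (errLim d ℓ (k + 1) *
      u d ℓ (k + 1) (t + 1) / 2)) ^ 2 -
      (Real.pi * (x * errLim d ℓ (k + 1) + errLim d ℓ (k + 1) / 2)) ^ 2| := by
    refine ge_of_tendsto h3 ?_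
    filter_upwards [hM, hK, hq.eventually_ge_atTop (t + 2)] with m hm hk hqm
    have hqm' : t + 2 ≤ q d (m * ℓ + k + 1) := hqm
    have hq0 : (0 : ℝ) < q d (m * ℓ + k + 1) := by exact_mod_cast q_succ_pos hpos _
    have hfac (j : ℕ) : 2 * κ / (K + 1) / q d (m * ℓ + k + 1) ≤
        2 * |Real.sin (Real.pi * (j + x * scaledErr d (m * ℓ + k + 1) +
          scaledErr d (m * ℓ + k + 1) * offset d (m * ℓ + k) j) / q d (m * ℓ + k + 1))| := by
      obtain ⟨g1, g2⟩ := Finset.mem_Icc.1 (reorder_mem hpos (m * ℓ + k) j)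
      have g3 := hsin (reorder d (m * ℓ + k) j + M m) (by omega)
      have g4 : Real.pi * (((reorder d (m * ℓ + k) j + M m : ℕ) : ℝ) * cfValue d) =
          Real.pi * (reorder d (m * ℓ + k) j * cfValue d + (-1) ^ (m * ℓ + k + 1 + 1) *
            (x * scaledErr d (m * ℓ + k + 1) / q d (m * ℓ + k + 1))) + z m * Real.pi := by
        push_cast
        rw [add_mul, hm, (err_eq_sign_mul_and_ne_zero hpos (m * ℓ + k + 1)).1, scaledErr]
        field_simp
        ring
      rw [g4, abs_sin_add_int_mul_pi, abs_sin_reorder hpos] at g3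
      have g5 : ((reorder d (m * ℓ + k) j + M m : ℕ) : ℝ) ≤ (K + 1) * q d (m * ℓ + k + 1) := by
        have : reorder d (m * ℓ + k) j + M m ≤ (K + 1) * q d (m * ℓ + k + 1) := by
          rw [add_mul, one_mul]; omega
        exact_mod_cast this
      have g6 : (0 : ℝ) < ((reorder d (m * ℓ + k) j + M m : ℕ) : ℝ) := by
        exact_mod_cast (by omega)
      have g7 := div_le_div_of_nonneg_left hκ.le g6 g5
      rw [div_div, mul_div_assoc]
      linarith
    have hpf := pairFactor_eq hpos (m * ℓ + k) (x * scaledErr d (m * ℓ + k + 1))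
      (j := t + 1) (Finset.mem_Ico.2 ⟨by omega, by omega⟩)
    have hmul := mul_le_mul (hfac (t + 1)) (hfac (q d (m * ℓ + k + 1) - (t + 1)))
      (by positivity) (by positivity)
    rw [hpf, pairFactor] at hmul
    have hmul' := mul_le_mul_of_nonneg_left hmul (sq_nonneg (q d (m * ℓ + k + 1) : ℝ))
    have e1 : (q d (m * ℓ + k + 1) : ℝ) ^ 2 * (2 * κ / (K + 1) / q d (m * ℓ + k + 1) *
        (2 * κ / (K + 1) / q d (m * ℓ + k + 1))) = (2 * κ / (K + 1)) ^ 2 := by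
      field_simp
    rw [e1] at hmul'
    refine hmul'.trans (le_of_eq ?_)
    change _ = 4 * |((q d (m * ℓ + k + 1) : ℝ) * Real.sin (Real.pi * centre d (m * ℓ + k) (t + 1)
      / q d (m * ℓ + k + 1))) ^ 2 - ((q d (m * ℓ + k + 1) : ℝ) * Real.sin (Real.pi *
      (x * scaledErr d (m * ℓ + k + 1) + scaledErr d (m * ℓ + k + 1) / 2)
        / q d (m * ℓ + k + 1))) ^ 2|
    rw [mul_pow, mul_pow, ← mul_sub, abs_mul, abs_of_nonneg (sq_nonneg (q d (m * ℓ + k + 1) : ℝ))]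
    ring
  intro h0
  have e : (Real.pi * (errLim d ℓ (k + 1) * u d ℓ (k + 1) (t + 1) / 2)) ^ 2 -
      (Real.pi * (x * errLim d ℓ (k + 1) + errLim d ℓ (k + 1) / 2)) ^ 2 =
      (Real.pi * errLim d ℓ (k + 1) * u d ℓ (k + 1) (t + 1) / 2) ^ 2 *
        (1 - (1 + 2 * x) ^ 2 / u d ℓ (k + 1) (t + 1) ^ 2) := by
    field_simp
    ring
  rw [e, h0, mul_zero, abs_zero, mul_zero] at hge
  have : 0 < (2 * κ / (K + 1)) ^ 2 := by positivity
  linarith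

/-! ### Perturbed linear recurrences -/

/-- A subexponential solution of an expanding recurrence with vanishing perturbation vanishes in
the limit. -/
lemma tendsto_zero_of_expanding {A : ℝ} (hA : 1 < A) {y g : ℕ → ℝ}
    (hy : ∀ m, y (m + 1) = A * y m + g m) (hg : Tendsto g atTop (𝓝 0))
    (hsub : Tendsto (fun m => y m / A ^ m) atTop (𝓝 0)) : Tendsto y atTop (𝓝 0) := by
  have hA0 : 0 < A := by linarith
  rw [Metric.tendsto_atTop]
  intro ε hε
  have hε2 : 0 < ε / 2 * (A - 1) := by have := sub_pos.2 hA; positivity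
  obtain ⟨N, hN⟩ := Metric.tendsto_atTop.1 hg _ hε2
  refine ⟨N, fun m hm => ?_⟩
  rw [Real.dist_eq, sub_zero]
  by_contra! hcon
  -- the excess over `ε / 2` would grow like `A ^ j`
  have hgrow (j : ℕ) : A ^ j * (ε / 2) ≤ |y (m + j)| - ε / 2 := by
    induction j with
    | zero => rw [pow_zero, add_zero]; linarith
    | succ j ih =>
      have h1 := hN (m + j) (by omega)
      rw [Real.dist_eq, sub_zero] at h1
      have h2 : |A * y (m + j)| - |g (m + j)| ≤ |A * y (m + j) + g (m + j)| := by
        have := abs_sub_abs_le_abs_sub (A * y (m + j)) (-g (m + j))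
        rwa [abs_neg, sub_neg_eq_add] at this
      rw [abs_mul, abs_of_pos hA0] at h2
      rw [← add_assoc, hy, pow_succ]
      nlinarith
  have h3 := (hsub.comp (tendsto_add_atTop_nat m)).abs
  rw [abs_zero] at h3
  have h4 : ε / 2 / A ^ m ≤ 0 := by
    refine ge_of_tendsto' h3 fun j => ?_
    have h5 := hgrow j
    simp only [Function.comp]
    rw [abs_div, abs_of_pos (pow_pos hA0 (j + m)), div_le_div_iff₀ (by positivity) (by positivity),
      pow_add, add_comm j m]
    have h6 : 0 < A ^ m := by positivity
    have h7 : A ^ j * (ε / 2) ≤ |y (m + j)| := by linarith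
    nlinarith
  have : 0 < ε / 2 / A ^ m := by positivity
  linarith

lemma tendsto_zero_of_contracting {B : ℝ} (hB : |B| < 1) {x y : ℕ → ℝ}
    (hx : ∀ m, x (m + 1) = B * x m + y m) (hy : Tendsto y atTop (𝓝 0)) :
    Tendsto x atTop (𝓝 0) := by
  rw [Metric.tendsto_atTop]
  intro ε hε
  have hε2 : 0 < ε / 2 * (1 - |B|) := by have := sub_pos.2 hB; positivity
  obtain ⟨N, hN⟩ := Metric.tendsto_atTop.1 hy _ hε2
  have hdec (j : ℕ) : |x (N + j)| ≤ |B| ^ j * |x N| + ε / 2 := by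
    induction j with
    | zero => rw [pow_zero, add_zero]; linarith
    | succ j ih =>
      have h1 := hN (N + j) (by omega)
      rw [Real.dist_eq, sub_zero] at h1
      have h2 := abs_add_le (B * x (N + j)) (y (N + j))
      rw [abs_mul] at h2
      have h3 := mul_le_mul_of_nonneg_left ih (abs_nonneg B)
      rw [← add_assoc, hx, pow_succ]
      nlinarith
  have h4 : Tendsto (fun j : ℕ => |B| ^ j * |x N|) atTop (𝓝 0) := by
    simpa using (tendsto_pow_atTop_nhds_zero_of_lt_one (abs_nonneg B) hB).mul_const |x N|
  obtain ⟨J, hJ⟩ := (h4.eventually_lt_const (half_pos hε)).exists_forall_of_atTop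
  refine ⟨N + J, fun m hm => ?_⟩
  obtain ⟨j, rfl⟩ := Nat.exists_eq_add_of_le (show N ≤ m by omega)
  rw [Real.dist_eq, sub_zero]
  have h5 := hdec j
  have h6 := hJ j (by omega)
  linarith

/-- A subexponential solution of a perturbed hyperbolic recurrence of order two converges. -/
lemma tendsto_of_recurrence {A B h₀ : ℝ} (hA : 1 < A) (hB : |B| < 1) {x h : ℕ → ℝ}
    (hx : ∀ m, x (m + 2) = (A + B) * x (m + 1) - A * B * x m + h m)
    (hh : Tendsto h atTop (𝓝 h₀)) (hsub : Tendsto (fun m => x m / A ^ m) atTop (𝓝 0)) :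
    Tendsto x atTop (𝓝 (h₀ / ((1 - A) * (1 - B)))) := by
  have hA1 : 1 - A ≠ 0 := by linarith
  have hB1 : 1 - B ≠ 0 := by have := (abs_lt.1 hB).2; linarith
  have hA0 : 0 < A := by linarith
  have hy : Tendsto (fun m => x (m + 1) - B * x m - h₀ / (1 - A)) atTop (𝓝 0) := by
    refine tendsto_zero_of_expanding hA (g := fun m => h m - h₀) (fun m => ?_) ?_ ?_
    · rw [hx]; field_simp; ring
    · simpa using hh.sub_const h₀
    · have h1 := (hsub.comp (tendsto_add_atTop_nat 1)).const_mul A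
      have h2 := hsub.const_mul B
      have h3 : Tendsto (fun m : ℕ => h₀ / (1 - A) * (A ^ m)⁻¹) atTop (𝓝 0) := by
        simpa using (tendsto_pow_atTop_atTop_of_one_lt hA).inv_tendsto_atTop.const_mul
          (h₀ / (1 - A))
      have h4 := (h1.sub h2).sub h3
      simp only [mul_zero, sub_zero] at h4
      refine h4.congr fun m => ?_
      simp only [Function.comp, pow_succ]
      field_simp
  have hz : Tendsto (fun m => x m - h₀ / ((1 - A) * (1 - B))) atTop (𝓝 0) := by
    refine tendsto_zero_of_contracting hB (fun m => ?_) hy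
    field_simp
    ring
  simpa using hz.add_const (h₀ / ((1 - A) * (1 - B)))

/-! ### The limits along residue classes -/

lemma perturbedSudler_pos {d : ℤ → ℕ} (hpos : ∀ i, 1 ≤ d i) {n M : ℕ} {x : ℝ} {z : ℤ}
    (hM : M * cfValue d = x * err d (n + 1) + z) :
    0 < perturbedSudler d (n + 1) (x * scaledErr d (n + 1)) := by
  rw [← shifted_eq_perturbedSudler hpos n hM]
  exact shifted_pos (cfValue_irrational hpos) _ M

lemma perturbedSudler_zero_pos {d : ℤ → ℕ} (hpos : ∀ i, 1 ≤ d i) (n : ℕ) :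
    0 < perturbedSudler d n 0 := by
  rw [perturbedSudler_zero_eq]
  exact sudler_pos (cfValue_irrational hpos) _

lemma q_mono {d : ℤ → ℕ} (hpos : ∀ i, 1 ≤ d i) {m n : ℕ} (h : m ≤ n) : q d m ≤ q d n :=
  monotone_nat_of_le_succ (q_le_succ hpos) h

lemma odd_limProd_pos {d : ℤ → ℕ} {ℓ : ℕ} (hℓ : 1 ≤ ℓ) (hpos : ∀ i, 1 ≤ d i)
    (hper : ∀ i, d (i + ℓ) = d i) (ho : Odd ℓ) (k s : ℕ) :
    0 < limProd d ℓ (k + 1) (1 + 2 * (s - a d ℓ)) := by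
  refine limProd_pos hℓ hpos hper (k + 1) (one_sub_div_u_sq_ne_zero hℓ hpos hper k (s + 1)
    (fun m => q d ((m - 1) * ℓ + k + 1) + s * q d (m * ℓ + k + 1))
    (fun m => p d ((m - 1) * ℓ + k + 1) + s * p d (m * ℓ + k + 1)) ?_ ?_)
  · filter_upwards [eventually_ge_atTop 1] with m hm
    obtain ⟨m, rfl⟩ := Nat.exists_eq_add_of_le' hm
    have h := odd_block_start hℓ hpos hper ho (m * ℓ + k + 1) s
    rw [show m * ℓ + k + 1 + ℓ = (m + 1) * ℓ + k + 1 by ring] at h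
    rw [Nat.add_sub_cancel]
    exact h
  · refine Eventually.of_forall fun m => ?_
    have h : (m - 1) * ℓ ≤ m * ℓ := Nat.mul_le_mul_right _ (Nat.sub_le _ _)
    have := q_mono hpos (show (m - 1) * ℓ + k + 1 ≤ m * ℓ + k + 1 by omega)
    rw [add_mul, one_mul]
    omega

lemma even_limProd_pos {d : ℤ → ℕ} {ℓ : ℕ} (hℓ : 1 ≤ ℓ) (hpos : ∀ i, 1 ≤ d i)
    (hper : ∀ i, d (i + ℓ) = d i) (k s : ℕ) : 0 < limProd d ℓ (k + 1) (1 + 2 * (s : ℝ)) :=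
  limProd_pos hℓ hpos hper (k + 1) (one_sub_div_u_sq_ne_zero hℓ hpos hper k s
    (fun m => s * q d (m * ℓ + k + 1)) (fun m => s * p d (m * ℓ + k + 1))
    (Eventually.of_forall fun m => even_block_start d (m * ℓ + k + 1) s)
    (Eventually.of_forall fun _ => le_rfl))

lemma even_long_limProd_pos {d : ℤ → ℕ} {ℓ : ℕ} (hℓ : 1 ≤ ℓ) (hpos : ∀ i, 1 ≤ d i)
    (hper : ∀ i, d (i + ℓ) = d i) (he : Even ℓ) (k : ℕ) :
    0 < limProd d ℓ (k + 1) (1 + 2 * a d ℓ ^ 2) := by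
  refine limProd_pos hℓ hpos hper (k + 1) (one_sub_div_u_sq_ne_zero hℓ hpos hper k 1
    (fun m => q d ((m - 2) * ℓ + k + 1)) (fun m => p d ((m - 2) * ℓ + k + 1)) ?_ ?_)
  · filter_upwards [eventually_ge_atTop 2] with m hm
    obtain ⟨m, rfl⟩ := Nat.exists_eq_add_of_le' hm
    have h := even_long_block_start hℓ hpos hper he (m * ℓ + k + 1)
    rw [show m * ℓ + k + 1 + 2 * ℓ = (m + 2) * ℓ + k + 1 by ring] at h
    rw [Nat.add_sub_cancel]
    exact h
  · refine Eventually.of_forall fun m => ?_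
    have h : (m - 2) * ℓ ≤ m * ℓ := Nat.mul_le_mul_right _ (Nat.sub_le _ _)
    have := q_mono hpos (show (m - 2) * ℓ + k + 1 ≤ m * ℓ + k + 1 by omega)
    rw [one_mul]
    exact this

lemma relLim_mul {d : ℤ → ℕ} {ℓ : ℕ} (hℓ : 1 ≤ ℓ) (hpos : ∀ i, 1 ≤ d i)
    (hper : ∀ i, d (i + ℓ) = d i) (k : ℕ) (x : ℝ) :
    relLim d ℓ k (x * errLim d ℓ k) = |1 + x| * (limProd d ℓ k (1 + 2 * x) / limProd d ℓ k 1) := by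
  have hΛ := (errLim_pos hℓ hpos hper k).ne'
  rw [relLim, ← mul_assoc, mul_div_cancel_right₀ _ hΛ, mul_div_cancel_right₀ _ hΛ]

lemma relLim_zero {d : ℤ → ℕ} {ℓ : ℕ} (hℓ : 1 ≤ ℓ) (hpos : ∀ i, 1 ≤ d i)
    (hper : ∀ i, d (i + ℓ) = d i) (k : ℕ) : relLim d ℓ k 0 = 1 := by
  have h := relLim_mul hℓ hpos hper k 0
  rw [zero_mul, mul_zero, add_zero, div_self (limProd_one_pos hℓ hpos hper k).ne'] at h
  simpa using h

lemma tendsto_log_ratio {d : ℤ → ℕ} {ℓ : ℕ} (hℓ : 1 ≤ ℓ) (hpos : ∀ i, 1 ≤ d i)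
    (hper : ∀ i, d (i + ℓ) = d i) (k : ℕ) {x : ℝ} (hx : 1 + x ≠ 0)
    (hL : 0 < limProd d ℓ (k + 1) (1 + 2 * x)) :
    Tendsto (fun m : ℕ => Real.log (perturbedSudler d (m * ℓ + k + 1)
      (x * scaledErr d (m * ℓ + k + 1)) / perturbedSudler d (m * ℓ + k + 1) 0)) atTop
      (𝓝 (Real.log (|1 + x| * (limProd d ℓ (k + 1) (1 + 2 * x) / limProd d ℓ (k + 1) 1)))) := by
  have hL1 := limProd_one_pos hℓ hpos hper (k + 1)
  have h1 := tendsto_relLim hℓ hpos hper k (x * errLim d ℓ (k + 1))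
  rw [relLim_mul hℓ hpos hper] at h1
  have h2 := (tendsto_scaledErr hℓ hpos hper (k + 1)).const_mul x
  have h3 := h1.comp (tendsto_id.prodMk h2)
  exact h3.log (mul_ne_zero (abs_ne_zero.2 hx) (div_pos hL hL1).ne')

/-- The limit solves `x = x + c x + h` for the limit `h` of the inhomogeneity. -/
lemma tendsto_log_of_odd {d : ℤ → ℕ} {ℓ : ℕ} (hℓ : 1 ≤ ℓ) (hpos : ∀ i, 1 ≤ d i)
    (hper : ∀ i, d (i + ℓ) = d i) (ho : Odd ℓ) (k : ℕ) :
    Tendsto (fun m : ℕ => Real.log (perturbedSudler d (m * ℓ + k + 1) 0)) atTop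
      (𝓝 (∑ s ∈ Finset.range (c d ℓ), -(1 / (c d ℓ : ℝ)) * Real.log (|1 + (s - a d ℓ)| *
        (limProd d ℓ (k + 1) (1 + 2 * (s - a d ℓ)) / limProd d ℓ (k + 1) 1)))) := by
  obtain ⟨ha, hab⟩ := one_lt_a_and_a_mul_b hℓ hpos
  have hs := a_add_b d ℓ
  rw [ho.neg_one_pow] at hab
  have hc : (1 : ℝ) ≤ c d ℓ := by exact_mod_cast one_le_c hpos ℓ
  have hac : (c d ℓ : ℝ) < a d ℓ := by nlinarith
  have h := tendsto_of_recurrence ha (abs_b_lt_one hℓ hpos)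
    (x := fun m => Real.log (perturbedSudler d (m * ℓ + k + 1) 0))
    (h := fun m => ∑ s ∈ Finset.range (c d ℓ), Real.log (perturbedSudler d ((m + 1) * ℓ + k + 1)
      (((s : ℝ) - a d ℓ) * scaledErr d ((m + 1) * ℓ + k + 1)) /
        perturbedSudler d ((m + 1) * ℓ + k + 1) 0)) (fun m => ?_)
    (tendsto_finsetSum _ fun s hs' => ((tendsto_log_ratio hℓ hpos hper k
      (x := (s : ℝ) - a d ℓ) ?_ (odd_limProd_pos hℓ hpos hper ho k s)).comp
        (tendsto_add_atTop_nat 1)))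
    (tendsto_log_sudler_div hℓ hpos hper k)
  · convert h using 2
    rw [← Finset.mul_sum, show (1 - a d ℓ) * (1 - b d ℓ) = -(c d ℓ : ℝ) by
      linear_combination hab - hs, div_neg, neg_mul, one_div, inv_mul_eq_div]
  · have heq := sudler_odd_eq hℓ hpos hper ho (m * ℓ + k)
    rw [show m * ℓ + k + 1 + 2 * ℓ = (m + 2) * ℓ + k + 1 by ring,
      show m * ℓ + k + 1 + ℓ = (m + 1) * ℓ + k + 1 by ring] at heq
    have hfac (s : ℕ) : 0 < perturbedSudler d ((m + 1) * ℓ + k + 1)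
        (((s : ℝ) - a d ℓ) * scaledErr d ((m + 1) * ℓ + k + 1)) := by
      have hb := odd_block_start hℓ hpos hper ho (m * ℓ + k + 1) s
      rw [show m * ℓ + k + 1 + ℓ = (m + 1) * ℓ + k + 1 by ring] at hb
      exact perturbedSudler_pos hpos hb
    have h0 (n : ℕ) := (perturbedSudler_zero_pos hpos n).ne'
    simp only [Real.log_div (hfac _).ne' (h0 _)]
    rw [heq, Real.log_mul (h0 _) (Finset.prod_ne_zero_iff.2 fun s _ => (hfac s).ne'),
      Real.log_prod (fun s _ => (hfac s).ne'), Finset.sum_sub_distrib, hs, hab]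
    simp
    ring
  · have : (s : ℝ) + 1 ≤ c d ℓ := by exact_mod_cast Finset.mem_range.1 hs'
    intro h0
    linarith

/-- The limit solves `2 x = c x + h` for the limit `h` of the inhomogeneity. -/
lemma tendsto_log_of_even {d : ℤ → ℕ} {ℓ : ℕ} (hℓ : 1 ≤ ℓ) (hpos : ∀ i, 1 ≤ d i)
    (hper : ∀ i, d (i + ℓ) = d i) (he : Even ℓ) (k : ℕ) :
    Tendsto (fun m : ℕ => Real.log (perturbedSudler d (m * ℓ + k + 1) 0)) atTop
      (𝓝 (1 / ((c d ℓ : ℝ) - 2) * Real.log ((1 + a d ℓ ^ 2) *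
          (limProd d ℓ (k + 1) (1 + 2 * a d ℓ ^ 2) / limProd d ℓ (k + 1) 1)) +
        ∑ s ∈ Finset.Icc 1 (c d ℓ - 1), -(1 / ((c d ℓ : ℝ) - 2)) * Real.log ((1 + s) *
          (limProd d ℓ (k + 1) (1 + 2 * (s : ℝ)) / limProd d ℓ (k + 1) 1)))) := by
  obtain ⟨ha, hab⟩ := one_lt_a_and_a_mul_b hℓ hpos
  have hs := a_add_b d ℓ
  rw [he.neg_one_pow] at hab
  have hc3 : 3 ≤ c d ℓ := three_le_c hpos (by obtain ⟨r, rfl⟩ := he; omega)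
  have hc : (3 : ℝ) ≤ c d ℓ := by exact_mod_cast hc3
  have hL1 := limProd_one_pos hℓ hpos hper (k + 1)
  have ha2 : |1 + a d ℓ ^ 2| = 1 + a d ℓ ^ 2 := abs_of_pos (by positivity)
  have hlong := tendsto_log_ratio hℓ hpos hper k (x := a d ℓ ^ 2) (by positivity)
    (even_long_limProd_pos hℓ hpos hper he k)
  rw [ha2] at hlong
  have h := tendsto_of_recurrence ha (abs_b_lt_one hℓ hpos)
    (x := fun m => Real.log (perturbedSudler d (m * ℓ + k + 1) 0))
    (h := fun m => ∑ s ∈ Finset.range (c d ℓ), Real.log (perturbedSudler d ((m + 1) * ℓ + k + 1)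
      ((s : ℝ) * scaledErr d ((m + 1) * ℓ + k + 1)) /
        perturbedSudler d ((m + 1) * ℓ + k + 1) 0) -
      Real.log (perturbedSudler d ((m + 2) * ℓ + k + 1)
        (a d ℓ ^ 2 * scaledErr d ((m + 2) * ℓ + k + 1)) /
        perturbedSudler d ((m + 2) * ℓ + k + 1) 0)) (fun m => ?_)
    ((tendsto_finsetSum _ fun (s : ℕ) _ => ((tendsto_log_ratio hℓ hpos hper k
      (x := (s : ℝ)) (by positivity) (even_limProd_pos hℓ hpos hper k s)).comp
        (tendsto_add_atTop_nat 1))).sub (hlong.comp (tendsto_add_atTop_nat 2)))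
    (tendsto_log_sudler_div hℓ hpos hper k)
  · convert h using 2
    have hr : Finset.range (c d ℓ) = insert 0 (Finset.Icc 1 (c d ℓ - 1)) := by
      ext s; simp only [Finset.mem_range, Finset.mem_insert, Finset.mem_Icc]; omega
    have h2 : (c d ℓ : ℝ) - 2 ≠ 0 := by linarith
    rw [← Finset.mul_sum, show (1 - a d ℓ) * (1 - b d ℓ) = -((c d ℓ : ℝ) - 2) by
      linear_combination hab - hs, hr, Finset.sum_insert (by simp)]
    have habs (s : ℕ) : |1 + (s : ℝ)| = 1 + s := abs_of_pos (by positivity)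
    simp only [habs]
    have hzero : Real.log ((1 + ((0 : ℕ) : ℝ)) * (limProd d ℓ (k + 1) (1 + 2 * ((0 : ℕ) : ℝ)) /
        limProd d ℓ (k + 1) 1)) = 0 := by
      rw [Nat.cast_zero, mul_zero, add_zero, div_self hL1.ne']; simp
    rw [hzero, zero_add]
    generalize (∑ s ∈ Finset.Icc 1 (c d ℓ - 1), Real.log _) = S
    field_simp
    ring
  · have heq := sudler_even_eq hℓ hpos hper he (m * ℓ + k)
    rw [show m * ℓ + k + 1 + 2 * ℓ = (m + 2) * ℓ + k + 1 by ring,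
      show m * ℓ + k + 1 + ℓ = (m + 1) * ℓ + k + 1 by ring] at heq
    have hfac (s : ℕ) : 0 < perturbedSudler d ((m + 1) * ℓ + k + 1)
        ((s : ℝ) * scaledErr d ((m + 1) * ℓ + k + 1)) :=
      perturbedSudler_pos hpos (even_block_start d ((m + 1) * ℓ + k + 1) s)
    have hfac2 : 0 < perturbedSudler d ((m + 2) * ℓ + k + 1)
        (a d ℓ ^ 2 * scaledErr d ((m + 2) * ℓ + k + 1)) := by
      have hb := even_long_block_start hℓ hpos hper he (m * ℓ + k + 1)
      rw [show m * ℓ + k + 1 + 2 * ℓ = (m + 2) * ℓ + k + 1 by ring] at hb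
      exact perturbedSudler_pos hpos hb
    have h0 (n : ℕ) := (perturbedSudler_zero_pos hpos n).ne'
    have hlog := congrArg Real.log heq
    rw [Real.log_mul (h0 _) hfac2.ne', Real.log_prod (fun s _ => (hfac s).ne')] at hlog
    simp only [Real.log_div (hfac _).ne' (h0 _), Real.log_div hfac2.ne' (h0 _)]
    rw [Finset.sum_sub_distrib, ← hlog, hs, hab]
    simp
    ring

/-! ### Evaluation of the infinite products -/

lemma hasProd_rpow {f : ℕ → ℝ} {x : ℝ} (hf : ∀ t, 0 ≤ f t) (hx : 0 < x) (h : HasProd f x)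
    (e : ℝ) : HasProd (fun t => f t ^ e) (x ^ e) := by
  refine (Tendsto.rpow_const h (Or.inl hx.ne')).congr fun s => ?_
  rw [Real.finsetProd_rpow s f (fun t _ => hf t)]

lemma hasProd_one_sub_inv_sq {d : ℤ → ℕ} {ℓ : ℕ} (hℓ : 1 ≤ ℓ) (hpos : ∀ i, 1 ≤ d i)
    (hper : ∀ i, d (i + ℓ) = d i) (k : ℕ) :
    HasProd (fun t : ℕ => 1 - 1 / u d ℓ k (t + 1) ^ 2) (limProd d ℓ k 1) := by
  have h := hasProd_limProd hℓ hpos hper k 1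
  simp only [one_pow, abs_of_pos (one_sub_inv_u_sq_pos hℓ hpos hper k _)] at h
  exact h

lemma hasProd_oddFactor {d : ℤ → ℕ} {ℓ : ℕ} (hℓ : 1 ≤ ℓ) (hpos : ∀ i, 1 ≤ d i)
    (hper : ∀ i, d (i + ℓ) = d i) (ho : Odd ℓ) (k : ℕ) :
    HasProd (fun t : ℕ => oddFactor d ℓ (k + 1) (t + 1)) (limProd d ℓ (k + 1) 1 *
      ∏ s ∈ Finset.range (c d ℓ),
        limProd d ℓ (k + 1) (1 + 2 * (s - a d ℓ)) ^ (-(1 / (c d ℓ : ℝ)))) := by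
  refine (hasProd_one_sub_inv_sq hℓ hpos hper (k + 1)).mul (hasProd_prod fun s _ => ?_)
  rw [show ∀ x : ℝ, 1 + 2 * ((s : ℝ) - x) = 1 + 2 * s - 2 * x by intro x; ring]
  refine hasProd_rpow (fun _ => abs_nonneg _) ?_ (hasProd_limProd hℓ hpos hper (k + 1) _) _
  have := odd_limProd_pos hℓ hpos hper ho k s
  rwa [show ∀ x : ℝ, 1 + 2 * ((s : ℝ) - x) = 1 + 2 * s - 2 * x by intro x; ring] at this

lemma hasProd_evenFactor {d : ℤ → ℕ} {ℓ : ℕ} (hℓ : 1 ≤ ℓ) (hpos : ∀ i, 1 ≤ d i)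
    (hper : ∀ i, d (i + ℓ) = d i) (he : Even ℓ) (k : ℕ) :
    HasProd (fun t : ℕ => evenFactor d ℓ (k + 1) (t + 1)) (limProd d ℓ (k + 1) 1 *
      limProd d ℓ (k + 1) (1 + 2 * a d ℓ ^ 2) ^ (1 / ((c d ℓ : ℝ) - 2)) *
      ∏ s ∈ Finset.Icc 1 (c d ℓ - 1),
        limProd d ℓ (k + 1) (1 + 2 * (s : ℝ)) ^ (-(1 / ((c d ℓ : ℝ) - 2)))) :=
  ((hasProd_one_sub_inv_sq hℓ hpos hper (k + 1)).mul
    (hasProd_rpow (fun _ => abs_nonneg _) (even_long_limProd_pos hℓ hpos hper he k)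
      (hasProd_limProd hℓ hpos hper (k + 1) _) _)).mul
    (hasProd_prod fun s _ => hasProd_rpow (fun _ => abs_nonneg _)
      (even_limProd_pos hℓ hpos hper k s) (hasProd_limProd hℓ hpos hper (k + 1) _) _)

lemma exp_odd_eq {d : ℤ → ℕ} {ℓ : ℕ} (hℓ : 1 ≤ ℓ) (hpos : ∀ i, 1 ≤ d i)
    (hper : ∀ i, d (i + ℓ) = d i) (ho : Odd ℓ) (k : ℕ) :
    Real.exp (∑ s ∈ Finset.range (c d ℓ), -(1 / (c d ℓ : ℝ)) * Real.log (|1 + (s - a d ℓ)| *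
        (limProd d ℓ (k + 1) (1 + 2 * (s - a d ℓ)) / limProd d ℓ (k + 1) 1))) =
      1 / (∏ s ∈ Finset.Icc 1 (c d ℓ), |(s : ℝ) - a d ℓ| ^ (1 / (c d ℓ : ℝ))) *
        (limProd d ℓ (k + 1) 1 * ∏ s ∈ Finset.range (c d ℓ),
          limProd d ℓ (k + 1) (1 + 2 * (s - a d ℓ)) ^ (-(1 / (c d ℓ : ℝ)))) := by
  obtain ⟨ha, hab⟩ := one_lt_a_and_a_mul_b hℓ hpos
  have hs := a_add_b d ℓ
  rw [ho.neg_one_pow] at hab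
  have hc : (1 : ℝ) ≤ c d ℓ := by exact_mod_cast one_le_c hpos ℓ
  have hac : (c d ℓ : ℝ) < a d ℓ := by nlinarith
  have hL1 := limProd_one_pos hℓ hpos hper (k + 1)
  have hIcc : ∏ s ∈ Finset.Icc 1 (c d ℓ), |(s : ℝ) - a d ℓ| ^ (1 / (c d ℓ : ℝ)) =
      ∏ s ∈ Finset.range (c d ℓ), |1 + ((s : ℝ) - a d ℓ)| ^ (1 / (c d ℓ : ℝ)) := by
    rw [← Finset.Ico_add_one_right_eq_Icc, Finset.prod_Ico_eq_prod_range, Nat.add_sub_cancel]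
    refine Finset.prod_congr rfl fun s _ => ?_
    push_cast
    rw [add_sub_assoc]
  have hone : limProd d ℓ (k + 1) 1 =
      ∏ s ∈ Finset.range (c d ℓ), limProd d ℓ (k + 1) 1 ^ (1 / (c d ℓ : ℝ)) := by
    rw [Finset.prod_const, Finset.card_range, one_div, Real.rpow_inv_natCast_pow hL1.le]
    have := one_le_c hpos (d := d) ℓ
    omega
  rw [hIcc, Real.exp_sum, one_div (∏ s ∈ _, _), ← Finset.prod_inv_distrib]
  nth_rewrite 2 [hone]
  rw [← Finset.prod_mul_distrib, ← Finset.prod_mul_distrib]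
  refine Finset.prod_congr rfl fun s hs' => ?_
  have hs1 : (s : ℝ) + 1 ≤ c d ℓ := by exact_mod_cast Finset.mem_range.1 hs'
  have h1 : 0 < |1 + ((s : ℝ) - a d ℓ)| := abs_pos.2 (by intro h0; linarith)
  have h2 := odd_limProd_pos hℓ hpos hper ho k s
  rw [mul_comm, ← Real.rpow_def_of_pos (by positivity), Real.mul_rpow h1.le (by positivity),
    Real.div_rpow h2.le hL1.le, Real.rpow_neg h1.le, Real.rpow_neg hL1.le]
  field_simp

lemma exp_even_eq {d : ℤ → ℕ} {ℓ : ℕ} (hℓ : 1 ≤ ℓ) (hpos : ∀ i, 1 ≤ d i)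
    (hper : ∀ i, d (i + ℓ) = d i) (he : Even ℓ) (k : ℕ) :
    Real.exp (1 / ((c d ℓ : ℝ) - 2) * Real.log ((1 + a d ℓ ^ 2) *
          (limProd d ℓ (k + 1) (1 + 2 * a d ℓ ^ 2) / limProd d ℓ (k + 1) 1)) +
        ∑ s ∈ Finset.Icc 1 (c d ℓ - 1), -(1 / ((c d ℓ : ℝ) - 2)) * Real.log ((1 + s) *
          (limProd d ℓ (k + 1) (1 + 2 * (s : ℝ)) / limProd d ℓ (k + 1) 1))) =
      ((1 + a d ℓ ^ 2) / ((c d ℓ).factorial : ℝ)) ^ (1 / ((c d ℓ : ℝ) - 2)) *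
      (limProd d ℓ (k + 1) 1 *
      limProd d ℓ (k + 1) (1 + 2 * a d ℓ ^ 2) ^ (1 / ((c d ℓ : ℝ) - 2)) *
      ∏ s ∈ Finset.Icc 1 (c d ℓ - 1),
        limProd d ℓ (k + 1) (1 + 2 * (s : ℝ)) ^ (-(1 / ((c d ℓ : ℝ) - 2)))) := by
  have hc3 : 3 ≤ c d ℓ := three_le_c hpos (by obtain ⟨r, rfl⟩ := he; omega)
  have hc : (3 : ℝ) ≤ c d ℓ := by exact_mod_cast hc3
  have hc2 : (c d ℓ : ℝ) - 2 ≠ 0 := by linarith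
  have hL1 := limProd_one_pos hℓ hpos hper (k + 1)
  have hLa := even_long_limProd_pos hℓ hpos hper he k
  have hfact : ((c d ℓ).factorial : ℝ) = ∏ s ∈ Finset.Icc 1 (c d ℓ - 1), (1 + (s : ℝ)) := by
    obtain ⟨n, hn⟩ := Nat.exists_eq_add_of_le' (show 1 ≤ c d ℓ by omega)
    rw [hn, Nat.add_sub_cancel, ← Finset.Ico_add_one_right_eq_Icc, Finset.prod_Ico_eq_prod_range,
      Nat.add_sub_cancel, ← Finset.prod_range_add_one_eq_factorial, Finset.prod_range_succ']
    push_cast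
    simp only [mul_one]
    exact Finset.prod_congr rfl fun s _ => by ring
  set e := 1 / ((c d ℓ : ℝ) - 2) with he'
  have hone : limProd d ℓ (k + 1) 1 ^ e * limProd d ℓ (k + 1) 1 =
      ∏ s ∈ Finset.Icc 1 (c d ℓ - 1), limProd d ℓ (k + 1) 1 ^ e := by
    rw [Finset.prod_const, Nat.card_Icc, Nat.add_sub_cancel, ← Real.rpow_mul_natCast hL1.le,
      ← Real.rpow_add_one hL1.ne']
    congr 1
    rw [Nat.cast_sub (by omega), he']
    field_simp
    push_cast
    ring
  have hterm : ∀ s ∈ Finset.Icc 1 (c d ℓ - 1), Real.exp (-e * Real.log ((1 + (s : ℝ)) *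
      (limProd d ℓ (k + 1) (1 + 2 * (s : ℝ)) / limProd d ℓ (k + 1) 1))) =
      ((1 + (s : ℝ)) ^ e)⁻¹ * limProd d ℓ (k + 1) 1 ^ e *
        limProd d ℓ (k + 1) (1 + 2 * (s : ℝ)) ^ (-e) := by
    intro s _
    have h2 := even_limProd_pos hℓ hpos hper k s
    have h1 : (0 : ℝ) < 1 + s := by positivity
    rw [mul_comm, ← Real.rpow_def_of_pos (by positivity), Real.mul_rpow h1.le (by positivity),
      Real.div_rpow h2.le hL1.le, Real.rpow_neg h1.le, Real.rpow_neg hL1.le]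
    field_simp
  rw [Real.exp_add, Real.exp_sum, Finset.prod_congr rfl hterm, Finset.prod_mul_distrib,
    Finset.prod_mul_distrib, ← hone, Finset.prod_inv_distrib,
    Real.finsetProd_rpow _ _ (fun s _ => by positivity), ← hfact, mul_comm e,
    ← Real.rpow_def_of_pos (by positivity), Real.mul_rpow (by positivity) (by positivity),
    Real.div_rpow hLa.le hL1.le, Real.div_rpow (by positivity) (by positivity)]
  field_simp

/-! ### Existence of the limits -/

/-- Convergence in both variables jointly is locally uniform, because it makes the limit
continuous. -/
lemma tendstoLocallyUniformly_of_tendsto_prod {F : ℕ → ℝ → ℝ} {G : ℝ → ℝ}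
    (h : ∀ y, Tendsto (fun z : ℕ × ℝ => F z.1 z.2) (atTop ×ˢ 𝓝 y) (𝓝 (G y))) :
    TendstoLocallyUniformly F G atTop := by
  have hcont (y : ℝ) : Tendsto G (𝓝 y) (𝓝 (G y)) := by
    rw [Metric.tendsto_nhds]
    intro η hη
    have h1 := Metric.tendsto_nhds.1 (h y) (η / 2) (half_pos hη)
    have h2 := (eventually_swap_iff.1 h1).curry
    filter_upwards [h2] with ε hε
    have h3 : Tendsto (fun m : ℕ => F m ε) atTop (𝓝 (G ε)) :=
      (h ε).comp (tendsto_id.prodMk tendsto_const_nhds)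
    refine lt_of_le_of_lt (le_of_tendsto (h3.dist tendsto_const_nhds) ?_) (half_lt_self hη)
    filter_upwards [hε] with m hm
    exact le_of_lt hm
  rw [tendstoLocallyUniformly_iff_forall_tendsto]
  intro y
  exact (((hcont y).comp tendsto_snd).prodMk_nhds (h y)).mono_right (nhds_le_uniformity _)

lemma tendsto_sudler_and_perturbedSudler {d : ℤ → ℕ} {ℓ : ℕ} (hℓ : 1 ≤ ℓ) (hpos : ∀ i, 1 ≤ d i)
    (hper : ∀ i, d (i + ℓ) = d i) (k : ℕ) {x : ℝ}
    (hx : Tendsto (fun m : ℕ => Real.log (perturbedSudler d (m * ℓ + k + 1) 0)) atTop (𝓝 x)) :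
    Tendsto (fun m : ℕ => sudler (cfValue d) (q d (m * ℓ + (k + 1)))) atTop (𝓝 (Real.exp x)) ∧
      TendstoLocallyUniformly (fun (m : ℕ) (ε : ℝ) => perturbedSudler d (m * ℓ + (k + 1)) ε)
        (fun ε => Real.exp x * relLim d ℓ (k + 1) ε) atTop := by
  have hC : Tendsto (fun m : ℕ => perturbedSudler d (m * ℓ + k + 1) 0) atTop (𝓝 (Real.exp x)) := by
    refine hx.rexp.congr fun m => Real.exp_log (perturbedSudler_zero_pos hpos _)
  refine ⟨hC.congr fun m => perturbedSudler_zero_eq d _, ?_⟩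
  have key (y : ℝ) : Tendsto (fun z : ℕ × ℝ => perturbedSudler d (z.1 * ℓ + k + 1) z.2)
      (atTop ×ˢ 𝓝 y) (𝓝 (Real.exp x * relLim d ℓ (k + 1) y)) := by
    refine ((hC.comp (tendsto_fst (g := 𝓝 y))).mul (tendsto_relLim hℓ hpos hper k y)).congr
      fun z => ?_
    exact mul_div_cancel₀ _ (perturbedSudler_zero_pos hpos _).ne'
  exact tendstoLocallyUniformly_of_tendsto_prod
    (F := fun m ε => perturbedSudler d (m * ℓ + k + 1) ε) key

lemma exists_limits {d : ℤ → ℕ} {ℓ : ℕ} (hℓ : 1 ≤ ℓ) (hpos : ∀ i, 1 ≤ d i)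
    (hper : ∀ i, d (i + ℓ) = d i) (k : ℕ) (hk : k ∈ Finset.Icc 1 ℓ) :
    ∃ (C : ℝ) (G : ℝ → ℝ),
      0 < C ∧
      Tendsto (fun m : ℕ => sudler (cfValue d) (q d (m * ℓ + k))) atTop (𝓝 C) ∧
      TendstoLocallyUniformly (fun (m : ℕ) (ε : ℝ) => perturbedSudler d (m * ℓ + k) ε) G atTop ∧
      C = G 0 ∧
      (Even ℓ →
        Multipliable (fun t : ℕ => evenFactor d ℓ k (t + 1)) ∧
        C = ((1 + a d ℓ ^ 2) / ((c d ℓ).factorial : ℝ)) ^ (1 / ((c d ℓ : ℝ) - 2))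
            * ∏' t : ℕ, evenFactor d ℓ k (t + 1)) ∧
      (Odd ℓ →
        Multipliable (fun t : ℕ => oddFactor d ℓ k (t + 1)) ∧
        C = 1 / (∏ s ∈ Finset.Icc 1 (c d ℓ), |(s : ℝ) - a d ℓ| ^ (1 / (c d ℓ : ℝ)))
            * ∏' t : ℕ, oddFactor d ℓ k (t + 1)) := by
  obtain ⟨k, rfl⟩ := Nat.exists_eq_add_of_le' (Finset.mem_Icc.1 hk).1
  rcases Nat.even_or_odd ℓ with he | ho
  · obtain ⟨h1, h2⟩ := tendsto_sudler_and_perturbedSudler hℓ hpos hper k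
      (tendsto_log_of_even hℓ hpos hper he k)
    refine ⟨_, _, Real.exp_pos _, h1, h2, by simp [relLim_zero hℓ hpos hper], fun _ => ?_,
      fun ho => absurd he (Nat.not_even_iff_odd.2 ho)⟩
    have h := hasProd_evenFactor hℓ hpos hper he k
    exact ⟨h.multipliable, by rw [h.tprod_eq, exp_even_eq hℓ hpos hper he]⟩
  · obtain ⟨h1, h2⟩ := tendsto_sudler_and_perturbedSudler hℓ hpos hper k
      (tendsto_log_of_odd hℓ hpos hper ho k)
    refine ⟨_, _, Real.exp_pos _, h1, h2, by simp [relLim_zero hℓ hpos hper],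
      fun he => absurd he (Nat.not_even_iff_odd.2 ho), fun _ => ?_⟩
    have h := hasProd_oddFactor hℓ hpos hper ho k
    exact ⟨h.multipliable, by rw [h.tprod_eq, exp_odd_eq hℓ hpos hper ho]⟩

end SudlerCF

theorem corollary1 (ℓ : ℕ) (hℓ : 1 ≤ ℓ) (d : ℤ → ℕ) (hpos : ∀ i, 1 ≤ d i)
    (hper : ∀ i, d (i + ℓ) = d i) :
    ∃ (C : ℕ → ℝ) (G : ℕ → ℝ → ℝ), ∀ k ∈ Finset.Icc 1 ℓ,
      0 < C k ∧
      Tendsto (fun m : ℕ => SudlerCF.sudler (SudlerCF.cfValue d) (SudlerCF.q d (m * ℓ + k)))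
        atTop (𝓝 (C k)) ∧
      TendstoLocallyUniformly
        (fun (m : ℕ) (ε : ℝ) => SudlerCF.perturbedSudler d (m * ℓ + k) ε) (G k) atTop ∧
      C k = G k 0 ∧
      (Even ℓ →
        Multipliable (fun t : ℕ => SudlerCF.evenFactor d ℓ k (t + 1)) ∧
        C k = ((1 + SudlerCF.a d ℓ ^ 2) / ((SudlerCF.c d ℓ).factorial : ℝ))
              ^ (1 / ((SudlerCF.c d ℓ : ℝ) - 2))
            * ∏' t : ℕ, SudlerCF.evenFactor d ℓ k (t + 1)) ∧
      (Odd ℓ →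
        Multipliable (fun t : ℕ => SudlerCF.oddFactor d ℓ k (t + 1)) ∧
        C k = 1 / (∏ s ∈ Finset.Icc 1 (SudlerCF.c d ℓ),
              |(s : ℝ) - SudlerCF.a d ℓ| ^ (1 / (SudlerCF.c d ℓ : ℝ)))
            * ∏' t : ℕ, SudlerCF.oddFactor d ℓ k (t + 1)) := by
  choose! C G h using fun k hk => SudlerCF.exists_limits hℓ hpos hper k hk
  exact ⟨C, G, h⟩
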